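/- Let $M$ be a smooth manifold of dimension $n$. Let $A^k(M)=\Gamma(\wedge^kTM)$ be the space of smooth $k$-vector fields and $\Omega^l(M)$ the space of smooth $l$-forms (both zero in negative degrees), $\mathcal A(M)=\bigoplus_{k}A^k(M)$, and let $[\cdot,\cdot]$ be the Schouten--Nijenhuis bracket. Forms are evaluated on multivector fields through $(\alpha_1\wedge\cdots\wedge\alpha_l)(v_1\wedge\cdots\wedge v_l)=\det(\alpha_i(v_j))$, with $\eta(f):=f\eta$ for $\eta\in\Omega^0(M)$ and $f\in A^0(M)=C^\infty(M)$. For $X\in A^k(M)$ and $\omega\in\Omega^l(M)$, the interior product $i_X\omega\in\Omega^{l-k}(M)$ is given by $(i_X\omega)(Y)=\omega(X\wedge Y)$ (so $i_X\omega=\omega(X)$ if $k=l$, $i_X\omega=0$ if $k>l$, and $i_f\omega=f\omega$ for a function $f$), and for $k\geq 1$ the Lie derivative is $L_X\omega=d\,i_X\omega-(-1)^k i_X\,d\omega$. A higher affine connection on $M$ is a map $\nabla:\mathcal A(M)\times\mathcal A(M)\to\mathcal A(M)$, $(X,Y)\mapsto\nabla_XY$, such that $\nabla_XY\in A^{k+l-1}(M)$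 for $X\in A^k(M)$, $Y\in A^l(M)$; $\nabla_{fX+X'}Y=f\nabla_XY+\nabla_{X'}Y$ and $\nabla_X(Y+Y')=\nabla_XY+\nabla_XY'$ for $f\in C^\infty(M)$ and $X,X',Y,Y'\in\mathcal A(M)$; $\nabla_Xf=[X,f]$ and $\nabla_X(fY)=[X,f]\wedge Y+f\nabla_XY$ for $X\in A^k(M)$, $f\in C^\infty(M)$, $Y\in\mathcal A(M)$; and $\nabla_fX=0$ for $f\in C^\infty(M)$, $X\in\mathcal A(M)$. It is upper induced if $\nabla_X(Y\wedge Z)=(\nabla_XY)\wedge Z+(-1)^{(k-1)l}\,Y\wedge\nabla_XZ$ for all $X\in A^k(M)$, $Y\in A^l(M)$, $Z\in\mathcal A(M)$. For $X\in A^k(M)$ with $k>0$ and $\omega\in\Omega^l(M)$ with $l-k+1\ge 0$, the covariant derivative $\nabla_X\omega\in\Omega^{l-k+1}(M)$ is the form with $$(\nabla_X\omega)(Y)=(-1)^{(k-1)(l-1)}L_Xi_Y\omega-\omega(\nabla_XY)\qquad\text{for all }Y\in A^{l-k+1}(M),$$ and $\nabla_X\omega:=0$ if $k=0$ or $l-k+1<0$.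 **Theorem.** Let $\nabla$ be a higher affine connection on $M$, let $X\in A^k(M)$ with $k>0$, and let $\omega\in\Omega^l(M)$. If $l-k+1\ge 0$, there is exactly one form $\nabla_X\omega\in\Omega^{l-k+1}(M)$ as above. For every $f\in C^\infty(M)$: (i) $\nabla_{fX}\omega=f\nabla_X\omega$; (ii) $\nabla_X(f\omega)=f\nabla_X\omega+i_{[X,f]}\omega$. If $\nabla$ is moreover upper induced, then for every $j$ and every $W\in A^j(M)$: (iii) $\nabla_X(i_W\omega)=(-1)^{j(k-1)}\left(i_W\nabla_X\omega+i_{\nabla_XW}\omega\right)$. -/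

import Mathlib

open scoped Manifold ContDiff

namespace HigherAffine

noncomputable section

/-! ### Multivector fields and differential forms -/

/-- A (not necessarily smooth) section `x ↦ X x ∈ ⋀ T_x M` of the full exterior bundle of an
`n`-manifold. The exterior product is the pointwise product `X * Y` in the exterior algebras, and a
function `f : M → ℝ` acts by `f • X`. -/
abbrev MultivectorField (n : ℕ) (M : Type*) [TopologicalSpace M]
    [ChartedSpace (EuclideanSpace ℝ (Fin n)) M] : Type _ :=
  (x : M) → ExteriorAlgebra ℝ (TangentSpace (𝓡 n) x)

/-- A (not necessarily smooth, not necessarily homogeneous) differential form, where `⋀^l T_x^* M` is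
identified with the dual of `⋀^l T_x M` through `(α₁ ∧ ⋯ ∧ α_l)(v₁ ∧ ⋯ ∧ v_l) = det (α_i v_j)`:
`θ x` is a linear functional on `⋀ T_x M = ⨁_l ⋀^l T_x M`. The value of `θ` on a multivector field
`Y` at `x` is `θ x (Y x)`; a function `f` is the form that takes the value `f x * g` on
`g ∈ ⋀^0 T_x M = ℝ`. -/
abbrev FormField (n : ℕ) (M : Type*) [TopologicalSpace M]
    [ChartedSpace (EuclideanSpace ℝ (Fin n)) M] : Type _ :=
  (x : M) → (ExteriorAlgebra ℝ (TangentSpace (𝓡 n) x) →ₗ[ℝ] ℝ)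

/-- The exterior power `⋀^k V`, with `⋀^k V = 0` for `k < 0`. -/
def extPow (V : Type*) [AddCommGroup V] [Module ℝ V] : ℤ → Submodule ℝ (ExteriorAlgebra ℝ V)
  | Int.ofNat k => ⋀[ℝ]^k V
  | Int.negSucc _ => ⊥

/-- The basis `e_{i₁} ∧ ⋯ ∧ e_{i_k}`, `i₁ < ⋯ < i_k`, of `⋀ ℝⁿ`. -/
def wedgeBasis (n : ℕ) :
    Module.Basis (Finset (Fin n)) ℝ (ExteriorAlgebra ℝ (EuclideanSpace ℝ (Fin n))) :=
  (EuclideanSpace.basisFun (Fin n) ℝ).toBasis.ExteriorAlgebra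

variable {n : ℕ} {M : Type*} [TopologicalSpace M] [ChartedSpace (EuclideanSpace ℝ (Fin n)) M]

/-- The differential at `x` of the chart `φ` around `x₀`. -/
def chartDiff (x₀ x : M) : TangentSpace (𝓡 n) x →ₗ[ℝ] EuclideanSpace ℝ (Fin n) :=
  (mfderiv (𝓡 n) 𝓘(ℝ, EuclideanSpace ℝ (Fin n)) (extChartAt (𝓡 n) x₀) x).toLinearMap

/-- The differential at `y` of the inverse `φ⁻¹` of the chart `φ` around `x₀`. -/
def chartSymmDiff (x₀ : M) (y : EuclideanSpace ℝ (Fin n)) :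
    EuclideanSpace ℝ (Fin n) →ₗ[ℝ] TangentSpace (𝓡 n) ((extChartAt (𝓡 n) x₀).symm y) :=
  (mfderiv 𝓘(ℝ, EuclideanSpace ℝ (Fin n)) (𝓡 n) (extChartAt (𝓡 n) x₀).symm y).toLinearMap

/-- The representation of a multivector field in the chart `φ` around `x₀`: the push-forward by
`φ`. -/
def MultivectorField.inChart (X : MultivectorField n M) (x₀ : M) (y : EuclideanSpace ℝ (Fin n)) :
    ExteriorAlgebra ℝ (EuclideanSpace ℝ (Fin n)) :=
  ExteriorAlgebra.map (chartDiff x₀ ((extChartAt (𝓡 n) x₀).symm y))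
    (X ((extChartAt (𝓡 n) x₀).symm y))

/-- The representation of a form in the chart `φ` around `x₀`: the pull-back by `φ⁻¹`. -/
def FormField.inChart (θ : FormField n M) (x₀ : M) (y : EuclideanSpace ℝ (Fin n)) :
    ExteriorAlgebra ℝ (EuclideanSpace ℝ (Fin n)) →ₗ[ℝ] ℝ :=
  (θ ((extChartAt (𝓡 n) x₀).symm y)) ∘ₗ (ExteriorAlgebra.map (chartSymmDiff x₀ y)).toLinearMap

/-- `X ∈ 𝒜(M)`: all components of `X` in all charts are smooth. -/
def MultivectorField.IsSmooth (X : MultivectorField n M) : Prop :=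
  ∀ (x₀ : M) (s : Finset (Fin n)),
    ContDiffOn ℝ ∞ (fun y => (wedgeBasis n).repr (X.inChart x₀ y) s) (extChartAt (𝓡 n) x₀).target

/-- All components of `θ` in all charts are smooth. -/
def FormField.IsSmooth (θ : FormField n M) : Prop :=
  ∀ (x₀ : M) (s : Finset (Fin n)),
    ContDiffOn ℝ ∞ (fun y => θ.inChart x₀ y (wedgeBasis n s)) (extChartAt (𝓡 n) x₀).target

/-- `X ∈ A^k(M)`: `X` is a smooth `k`-vector field (and `A^k(M) = 0` for `k < 0`). -/
def MultivectorField.IsKVector (k : ℤ) (X : MultivectorField n M) : Prop :=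
  X.IsSmooth ∧ ∀ x, X x ∈ extPow (TangentSpace (𝓡 n) x) k

/-- `θ ∈ Ω^l(M)`: `θ` is a smooth `l`-form, i.e. it vanishes on the multivectors of all other degrees
(and `Ω^l(M) = 0` for `l < 0`). -/
def FormField.IsForm (l : ℤ) (θ : FormField n M) : Prop :=
  θ.IsSmooth ∧ ∀ (x : M) (m : ℤ), m ≠ l → ∀ v ∈ extPow (TangentSpace (𝓡 n) x) m, θ x v = 0

/-- `f ∈ C^∞(M)`. -/
def IsSmoothFun (n : ℕ) {M : Type*} [TopologicalSpace M]
    [ChartedSpace (EuclideanSpace ℝ (Fin n)) M] (f : M → ℝ) : Prop :=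
  ContMDiff (𝓡 n) 𝓘(ℝ, ℝ) ∞ f

/-- A function regarded as a `0`-vector field. -/
def ofFun (n : ℕ) {M : Type*} [TopologicalSpace M]
    [ChartedSpace (EuclideanSpace ℝ (Fin n)) M] (f : M → ℝ) : MultivectorField n M :=
  fun x => algebraMap ℝ (ExteriorAlgebra ℝ (TangentSpace (𝓡 n) x)) (f x)

/-! ### The Schouten-Nijenhuis bracket -/

/-- The componentwise partial derivative `∂P/∂y^i` of a map `P : ℝⁿ → ⋀ ℝⁿ`. -/
def partialDeriv (i : Fin n)
    (P : EuclideanSpace ℝ (Fin n) → ExteriorAlgebra ℝ (EuclideanSpace ℝ (Fin n)))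
    (y : EuclideanSpace ℝ (Fin n)) : ExteriorAlgebra ℝ (EuclideanSpace ℝ (Fin n)) :=
  ∑ s : Finset (Fin n),
    fderiv ℝ (fun z => (wedgeBasis n).repr (P z) s) y (EuclideanSpace.single i 1) • wedgeBasis n s

/-- The contraction from the right with the coordinate covector `dy^i`:
`v₁ ∧ ⋯ ∧ v_p ↦ ∑_a (-1)^(p-a) (v_a)^i v₁ ∧ ⋯ ∧ v̂_a ∧ ⋯ ∧ v_p`. -/
def contractCoord (i : Fin n) (v : ExteriorAlgebra ℝ (EuclideanSpace ℝ (Fin n))) :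
    ExteriorAlgebra ℝ (EuclideanSpace ℝ (Fin n)) :=
  CliffordAlgebra.contractRight v ((EuclideanSpace.basisFun (Fin n) ℝ).toBasis.coord i)

/-- The Schouten-Nijenhuis bracket `[P, Q]` of a `p`-vector field `P` and a `q`-vector field `Q`, by
its expression
`[P, Q] = ∑_i ((P ⌊ dy^i) ∧ ∂_i Q - (-1)^((p-1)(q-1)) (Q ⌊ dy^i) ∧ ∂_i P)`
in local coordinates (at `x` those of the preferred chart at `x`). This is the bracket with
`[f, g] = 0` for functions, `[X, Q] = L_X Q` for vector fields `X`,
`[P, Q] = -(-1)^((p-1)(q-1)) [Q, P]` and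
`[P, Q ∧ R] = [P, Q] ∧ R + (-1)^((p-1)q) Q ∧ [P, R]`. -/
def schouten (p q : ℤ) (P Q : MultivectorField n M) : MultivectorField n M := fun x =>
  ExteriorAlgebra.map
    ((mfderiv (𝓡 n) 𝓘(ℝ, EuclideanSpace ℝ (Fin n)) (extChartAt (𝓡 n) x) x).inverse.toLinearMap :
      EuclideanSpace ℝ (Fin n) →ₗ[ℝ] TangentSpace (𝓡 n) x)
    (∑ i : Fin n,
      (contractCoord i (P.inChart x (extChartAt (𝓡 n) x x)) *
          partialDeriv i (Q.inChart x) (extChartAt (𝓡 n) x x) -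
        ((-1 : ℝ) ^ ((p - 1) * (q - 1))) •
          (contractCoord i (Q.inChart x (extChartAt (𝓡 n) x x)) *
            partialDeriv i (P.inChart x) (extChartAt (𝓡 n) x x))))

/-! ### Interior product, exterior derivative and Lie derivative of forms -/

/-- The interior product, `(i_X θ)(Y) = θ(X ∧ Y)`. For `X ∈ A^k(M)` and `θ ∈ Ω^l(M)` this is
`θ(X)` if `k = l`, it is `0` if `k > l`, and it is `f θ` if `X` is a function `f`. -/
def interior (X : MultivectorField n M) (θ : FormField n M) : FormField n M :=
  fun x => θ x ∘ₗ LinearMap.mulLeft ℝ (X x)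

/-- A multilinear map on a power of `ℝⁿ` is continuous. -/
theorem continuous_multilinear {l : ℕ}
    (f : MultilinearMap ℝ (fun _ : Fin l => EuclideanSpace ℝ (Fin n)) ℝ) : Continuous f := by
  have h : (f : (Fin l → EuclideanSpace ℝ (Fin n)) → ℝ) = fun v =>
      ∑ r : Fin l → Fin n, (∏ i, v i (r i)) * f (fun i => EuclideanSpace.single (r i) 1) := by
    funext v
    have hv : v = fun i => ∑ j, v i j • EuclideanSpace.single j (1 : ℝ) := by
      funext i
      have := (EuclideanSpace.basisFun (Fin n) ℝ).sum_repr (v i)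
      simpa using this.symm
    conv_lhs => rw [hv]
    rw [f.map_sum]
    refine Finset.sum_congr rfl fun r _ => ?_
    rw [f.map_smul_univ (fun i => v i (r i)) (fun i => EuclideanSpace.single (r i) 1), smul_eq_mul]
  rw [h]
  fun_prop

/-- The degree `l` part of a linear functional on `⋀ ℝⁿ`, as an alternating map. -/
def altPart (l : ℕ) (α : ExteriorAlgebra ℝ (EuclideanSpace ℝ (Fin n)) →ₗ[ℝ] ℝ) :
    EuclideanSpace ℝ (Fin n) [⋀^Fin l]→L[ℝ] ℝ :=
  { α.compAlternatingMap (ExteriorAlgebra.ιMulti ℝ l) with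
    cont := continuous_multilinear
      (α.compAlternatingMap (ExteriorAlgebra.ιMulti ℝ l)).toMultilinearMap }

/-- The linear functional on `⋀ ℝⁿ` whose degree `l + 1` part is the exterior derivative at `y` of
the degree `l` part of `α`. -/
def extDerivFlat
    (α : EuclideanSpace ℝ (Fin n) → (ExteriorAlgebra ℝ (EuclideanSpace ℝ (Fin n)) →ₗ[ℝ] ℝ))
    (y : EuclideanSpace ℝ (Fin n)) : ExteriorAlgebra ℝ (EuclideanSpace ℝ (Fin n)) →ₗ[ℝ] ℝ :=
  ExteriorAlgebra.liftAlternating fun l => match l with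
    | 0 => 0
    | l + 1 => (extDeriv (fun z => altPart l (α z)) y).toAlternatingMap

/-- The exterior derivative of forms on `M`, computed at `x` in the preferred chart at `x`. -/
def extDer (θ : FormField n M) : FormField n M := fun x =>
  extDerivFlat (θ.inChart x) (extChartAt (𝓡 n) x x) ∘ₗ
    (ExteriorAlgebra.map (chartDiff x x)).toLinearMap

/-- The Lie derivative `L_X θ = d i_X θ - (-1)^k i_X dθ` along `X ∈ A^k(M)`. -/
def lieDer (k : ℤ) (X : MultivectorField n M) (θ : FormField n M) : FormField n M :=
  extDer (interior X θ) - ((-1 : ℝ) ^ k) • interior X (extDer θ)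

/-! ### Higher affine connections -/

/-- A higher affine connection on `M`, i.e. a map `∇ : 𝒜(M) × 𝒜(M) → 𝒜(M)`; `D X Y` is `∇_X Y`.
Its values on sections that are not smooth are irrelevant. -/
structure HigherConnection (n : ℕ) (M : Type*) [TopologicalSpace M]
    [ChartedSpace (EuclideanSpace ℝ (Fin n)) M] where
  D : MultivectorField n M → MultivectorField n M → MultivectorField n M
  smooth : ∀ X Y : MultivectorField n M, X.IsSmooth → Y.IsSmooth → (D X Y).IsSmooth
  degree : ∀ (k l : ℤ) (X Y : MultivectorField n M), X.IsKVector k → Y.IsKVector l →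
    (D X Y).IsKVector (k + l - 1)
  linear_left : ∀ (f : M → ℝ) (X X' Y : MultivectorField n M), IsSmoothFun n f →
    X.IsSmooth → X'.IsSmooth → Y.IsSmooth → D (f • X + X') Y = f • D X Y + D X' Y
  add_right : ∀ X Y Y' : MultivectorField n M, X.IsSmooth → Y.IsSmooth → Y'.IsSmooth →
    D X (Y + Y') = D X Y + D X Y'
  apply_fun : ∀ (k : ℤ) (X : MultivectorField n M) (f : M → ℝ), X.IsKVector k →
    IsSmoothFun n f → D X (ofFun n f) = schouten k 0 X (ofFun n f)
  leibniz : ∀ (k : ℤ) (X Y : MultivectorField n M) (f : M → ℝ), X.IsKVector k →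
    IsSmoothFun n f → Y.IsSmooth → D X (f • Y) = schouten k 0 X (ofFun n f) * Y + f • D X Y
  fun_left : ∀ (f : M → ℝ) (X : MultivectorField n M), IsSmoothFun n f → X.IsSmooth →
    D (ofFun n f) X = 0

namespace HigherConnection

/-- `∇` is upper induced: `∇_X (Y ∧ Z) = (∇_X Y) ∧ Z + (-1)^((k-1)l) Y ∧ ∇_X Z` for `X ∈ A^k(M)`,
`Y ∈ A^l(M)`, `Z ∈ 𝒜(M)`. -/
def IsUpperInduced (C : HigherConnection n M) : Prop :=
  ∀ (k l : ℤ) (X Y Z : MultivectorField n M), X.IsKVector k → Y.IsKVector l → Z.IsSmooth →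
    C.D X (Y * Z) = C.D X Y * Z + ((-1 : ℝ) ^ ((k - 1) * l)) • (Y * C.D X Z)

/-- `η` is the covariant derivative of `θ ∈ Ω^l(M)` along `X ∈ A^k(M)`: it is an `(l-k+1)`-form, and
`η(Y) = (-1)^((k-1)(l-1)) L_X i_Y θ - θ(∇_X Y)` for all `Y ∈ A^(l-k+1)(M)`. Here `L_X i_Y θ` is a
`0`-form; the function that it stands for is its value on `1 ∈ ⋀^0 T_x M`. -/
def IsCovDer (C : HigherConnection n M) (k l : ℤ) (X : MultivectorField n M)
    (θ η : FormField n M) : Prop :=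
  η.IsForm (l - k + 1) ∧
    ∀ Y : MultivectorField n M, Y.IsKVector (l - k + 1) → ∀ x : M,
      η x (Y x) =
        ((-1 : ℝ) ^ ((k - 1) * (l - 1))) * lieDer k X (interior Y θ) x 1 - θ x (C.D X Y x)

open Classical in
/-- The covariant derivative `∇_X θ` of `θ ∈ Ω^l(M)` along `X ∈ A^k(M)`: the form that `IsCovDer`
describes if `k > 0` and `l - k + 1 ≥ 0`, and `0` otherwise. -/
def covDer (C : HigherConnection n M) (k l : ℤ) (X : MultivectorField n M)
    (θ : FormField n M) : FormField n M :=
  if h : 0 < k ∧ 0 ≤ l - k + 1 ∧ ∃ η : FormField n M, C.IsCovDer k l X θ η then h.2.2.choose else 0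

end HigherConnection

end

end HigherAffine

namespace HigherAffine

open Filter Topology

/-! ### Exterior algebra -/

section Algebra

variable {V V' : Type*} [AddCommGroup V] [Module ℝ V] [AddCommGroup V'] [Module ℝ V']

/-! Fix `X` of degree `k` and `θ` of degree `l`, and let `E(Y)` be the value prescribed for the
covariant derivative on `Y` (`covExpr`). Everything rests on `E` being linear over smooth functions
in `Y`. The Lie derivative of `i_Y θ` is needed only on `1`, where `d i_X` contributes nothing; what
remains is, up to sign, `(d i_Y θ)(X)`. Replacing `Y` by `f Y` adds `(df ∧ i_Y θ)(X) = θ(Y ∧ ι_df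
X)`, where `ι_df` is contraction from the left. The connection adds `θ([X,f] ∧ Y)`, and `[X,f]` is
the contraction of `X` with `df` from the right. Passing from left to right contraction and
commuting the factors costs a sign that the factor `(-1)^((k-1)(l-1))` corrects exactly, so the two
extra terms cancel (`lieDer_smul_interior`, `covExpr_smul`).

A tensorial expression is a form. The coordinate multivector fields of a chart, cut off by a bump
function `ρ`, are global fields, and `ρ² Y` is a combination of them with global smooth coefficients
(`bump_sq_smul_eq_sum`). Hence `E(Y)` at `x` depends only on `Y x`, and the form `covForm` assembled
from the values of `E` on the frame takes the prescribed values. Uniqueness holds because the frame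
fields span every fibre (`FormField.IsForm.ext`).

The identities follow by comparing values. For (i), both terms of `E` are linear in `X` over
functions. For (ii), the same Leibniz computation leaves `θ([X,f] ∧ Y)`, which no longer cancels
because `f` multiplies `θ` and not `Y`. For (iii), `i_Y i_W θ = i_(W ∧ Y) θ`, and the upper induced
rule splits `∇_X (W ∧ Y)`. -/

theorem one_mem_exteriorPower_zero : (1 : ExteriorAlgebra ℝ V) ∈ ⋀[ℝ]^0 V := by
  change (1 : ExteriorAlgebra ℝ V) ∈ (LinearMap.range (ExteriorAlgebra.ι ℝ)) ^ 0
  rw [pow_zero]; exact Submodule.one_le.mp le_rfl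

theorem mul_mem_extPow {p q : ℤ} {a b : ExteriorAlgebra ℝ V} (ha : a ∈ extPow V p)
    (hb : b ∈ extPow V q) : a * b ∈ extPow V (p + q) := by
  cases p with
  | ofNat p =>
    cases q with
    | ofNat q =>
      have : a * b ∈ ⋀[ℝ]^(p + q) V := by
        change _ ∈ (LinearMap.range (ExteriorAlgebra.ι ℝ)) ^ (p + q)
        rw [pow_add]; exact Submodule.mul_mem_mul ha hb
      exact this
    | negSucc q =>
      have : b = 0 := by simpa [extPow] using hb
      simp [this]
  | negSucc p =>
    have : a = 0 := by simpa [extPow] using ha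
    simp [this]

theorem map_mem_extPow (f : V →ₗ[ℝ] V') {p : ℤ} {a : ExteriorAlgebra ℝ V}
    (ha : a ∈ extPow V p) : ExteriorAlgebra.map f a ∈ extPow V' p := by
  cases p with
  | ofNat p =>
    change a ∈ ⋀[ℝ]^p V at ha
    change _ ∈ ⋀[ℝ]^p V'
    rw [← ExteriorAlgebra.ιMulti_span_fixedDegree] at ha ⊢
    induction ha using Submodule.span_induction with
    | mem x hx =>
      obtain ⟨v, rfl⟩ := hx
      rw [ExteriorAlgebra.map_apply_ιMulti]
      exact Submodule.subset_span ⟨_, rfl⟩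
    | zero => simp
    | add x y _ _ hx hy => rw [map_add]; exact add_mem hx hy
    | smul c x _ hx => rw [map_smul]; exact Submodule.smul_mem _ _ hx
  | negSucc p =>
    have : a = 0 := by simpa [extPow] using ha
    simp [this]

/-- Iterating the antiderivation rule gives the alternating sum with one omitted argument, the shape
in which the exterior derivative is evaluated on vectors. -/
theorem contractLeft_ιMulti (d : Module.Dual ℝ V) {l : ℕ} (v : Fin (l + 1) → V) :
    CliffordAlgebra.contractLeft d (ExteriorAlgebra.ιMulti ℝ (l + 1) v) =
      ∑ i : Fin (l + 1), ((-1 : ℝ) ^ (i : ℕ) * d (v i)) •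
        ExteriorAlgebra.ιMulti ℝ l (i.removeNth v) := by
  induction l with
  | zero =>
    simp only [ExteriorAlgebra.ιMulti_succ_apply, ExteriorAlgebra.ιMulti_zero_apply, mul_one]
    erw [CliffordAlgebra.contractLeft_ι]
    simp [Algebra.algebraMap_eq_smul_one]
  | succ l ih =>
    rw [ExteriorAlgebra.ιMulti_succ_apply]
    erw [CliffordAlgebra.contractLeft_ι_mul]
    rw [ih, Fin.sum_univ_succ (n := l + 1), Finset.mul_sum]
    simp only [Fin.val_zero, pow_zero, one_mul, Fin.val_succ]
    rw [sub_eq_add_neg, ← Finset.sum_neg_distrib]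
    congr 1
    refine Finset.sum_congr rfl fun i _ => ?_
    rw [ExteriorAlgebra.ιMulti_succ_apply (i.succ.removeNth v)]
    have h1 : Matrix.vecTail (i.succ.removeNth v) = i.removeNth (Matrix.vecTail v) := by
      funext j
      simp [Matrix.vecTail, Fin.removeNth, Fin.succ_succAbove_succ]
    have h0 : i.succ.removeNth v 0 = v 0 := by
      simp [Fin.removeNth]
    rw [h1, h0, mul_smul_comm, ← neg_smul]
    congr 1
    simp [Matrix.vecTail, pow_succ]

theorem contractLeft_mem {k : ℕ} (d : Module.Dual ℝ V) {a : ExteriorAlgebra ℝ V}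
    (ha : a ∈ ⋀[ℝ]^(k + 1) V) : CliffordAlgebra.contractLeft d a ∈ ⋀[ℝ]^k V := by
  rw [← ExteriorAlgebra.ιMulti_span_fixedDegree] at ha ⊢
  induction ha using Submodule.span_induction with
  | mem x hx =>
    obtain ⟨v, rfl⟩ := hx
    rw [contractLeft_ιMulti]
    exact Submodule.sum_mem _ fun i _ => Submodule.smul_mem _ _ (Submodule.subset_span ⟨_, rfl⟩)
  | zero => simp
  | add x y _ _ hx hy => rw [map_add]; exact add_mem hx hy
  | smul c x _ hx => rw [map_smul]; exact Submodule.smul_mem _ _ hx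

theorem ι_mul_comm {q : ℕ} (m : V) {b : ExteriorAlgebra ℝ V} (hb : b ∈ ⋀[ℝ]^q V) :
    ExteriorAlgebra.ι ℝ m * b = ((-1 : ℝ) ^ q) • (b * ExteriorAlgebra.ι ℝ m) := by
  induction hb using Submodule.pow_induction_on_left' with
  | algebraMap r => simp [Algebra.commutes]
  | add x y i hx hy ihx ihy => rw [mul_add, ihx, ihy, add_mul, smul_add]
  | mem_mul m' hm' i x hx ih =>
    obtain ⟨m', rfl⟩ := hm'
    have h := ExteriorAlgebra.ι_add_mul_swap (R := ℝ) m m'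
    rw [← mul_assoc, eq_neg_of_add_eq_zero_left h, neg_mul, mul_assoc, ih, mul_smul_comm,
      ← mul_assoc, pow_succ, mul_neg_one, neg_smul]

theorem mul_comm_of_mem_exteriorPower {p q : ℕ} {a b : ExteriorAlgebra ℝ V}
    (ha : a ∈ ⋀[ℝ]^p V) (hb : b ∈ ⋀[ℝ]^q V) : a * b = ((-1 : ℝ) ^ (p * q)) • (b * a) := by
  induction ha using Submodule.pow_induction_on_left' with
  | algebraMap r => simp [Algebra.commutes]
  | add x y i hx hy ihx ihy => rw [add_mul, ihx, ihy, mul_add, smul_add]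
  | mem_mul m' hm' i x hx ih =>
    obtain ⟨m', rfl⟩ := hm'
    rw [mul_assoc, ih, mul_smul_comm, ← mul_assoc, ι_mul_comm m' hb, smul_mul_assoc, smul_smul,
      ← pow_add, mul_assoc, Nat.succ_mul]

theorem contractLeft_mul {p : ℕ} (d : Module.Dual ℝ V) {a : ExteriorAlgebra ℝ V}
    (ha : a ∈ ⋀[ℝ]^p V) (b : ExteriorAlgebra ℝ V) :
    CliffordAlgebra.contractLeft d (a * b) =
      CliffordAlgebra.contractLeft d a * b +
        ((-1 : ℝ) ^ p) • (a * CliffordAlgebra.contractLeft d b) := by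
  induction ha using Submodule.pow_induction_on_left' with
  | algebraMap r =>
    rw [CliffordAlgebra.contractLeft_algebraMap_mul, CliffordAlgebra.contractLeft_algebraMap]
    simp
  | add x y i hx hy ihx ihy =>
    rw [add_mul, map_add, ihx, ihy, map_add, add_mul, add_mul, smul_add]; abel
  | mem_mul m' hm' i x hx ih =>
    obtain ⟨m', rfl⟩ := hm'
    rw [mul_assoc]
    erw [CliffordAlgebra.contractLeft_ι_mul, CliffordAlgebra.contractLeft_ι_mul]
    rw [ih, sub_mul, mul_add, smul_mul_assoc, mul_smul_comm, pow_succ, mul_neg_one, neg_smul]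
    simp only [mul_assoc]
    erw [sub_add_eq_sub_sub]
    exact sub_eq_add_neg _ _

/-- The Schouten bracket contracts from the right, the exterior derivative from the left. Moving the
covector across the other `p - 1` factors produces this sign, since `p + 1` and `p - 1` have the
same parity. -/
theorem contractRight_eq_smul_contractLeft {p : ℕ} (d : Module.Dual ℝ V)
    {a : ExteriorAlgebra ℝ V} (ha : a ∈ ⋀[ℝ]^p V) :
    CliffordAlgebra.contractRight a d =
      ((-1 : ℝ) ^ (p + 1)) • CliffordAlgebra.contractLeft d a := by
  induction ha using Submodule.pow_induction_on_right' with
  | algebraMap r =>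
    rw [CliffordAlgebra.contractLeft_algebraMap, CliffordAlgebra.contractRight_algebraMap]
    simp
  | add x y i hx hy ihx ihy =>
    rw [map_add, LinearMap.add_apply, ihx, ihy, map_add, smul_add]
  | mul_mem i x hx ih m hm =>
    obtain ⟨m, rfl⟩ := hm
    rw [contractLeft_mul d hx]
    erw [CliffordAlgebra.contractRight_mul_ι, CliffordAlgebra.contractLeft_ι]
    erw [ih]
    rw [smul_add, smul_smul, ← pow_add, ← Algebra.commutes, ← Algebra.smul_def,
      show i + 1 + 1 + i = 2 * (i + 1) by ring, pow_mul]
    simp only [pow_succ, smul_mul_assoc]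
    simp only [neg_smul, mul_neg, mul_one, neg_neg, one_smul, pow_zero, one_pow, sub_neg_eq_add]
    module

/-- The sign in the exchange of a contracted multivector and a second factor. -/
theorem contractRight_mul_comm {p q : ℕ} (d : Module.Dual ℝ V) {a b : ExteriorAlgebra ℝ V}
    (ha : a ∈ ⋀[ℝ]^(p + 1) V) (hb : b ∈ ⋀[ℝ]^q V) :
    b * CliffordAlgebra.contractLeft d a =
      ((-1 : ℝ) ^ (p * q + p)) • (CliffordAlgebra.contractRight a d * b) := by
  rw [mul_comm_of_mem_exteriorPower hb (contractLeft_mem d ha),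
    contractRight_eq_smul_contractLeft d ha, smul_mul_assoc, smul_smul, ← pow_add]
  congr 1
  rw [show p * q + p + (p + 1 + 1) = q * p + 2 * (p + 1) by ring, pow_add, pow_mul _ 2]
  simp

end Algebra

/-! ### The monomial basis of `⋀ ℝⁿ` and its degrees -/

section Basis

variable {n : ℕ}

theorem wedgeBasis_mem (s : Finset (Fin n)) :
    wedgeBasis n s ∈ ⋀[ℝ]^s.card (EuclideanSpace ℝ (Fin n)) := by
  rw [wedgeBasis, ExteriorAlgebra.basis_apply, ← ExteriorAlgebra.ιMulti_span_fixedDegree]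
  exact Submodule.subset_span ⟨_, rfl⟩

theorem exists_wedgeBasis_eq_ιMulti (s : Finset (Fin n)) :
    ∃ v : Fin s.card → EuclideanSpace ℝ (Fin n),
      wedgeBasis n s = ExteriorAlgebra.ιMulti ℝ s.card v := by
  rw [wedgeBasis, ExteriorAlgebra.basis_apply]
  exact ⟨_, rfl⟩

theorem wedgeBasis_empty : wedgeBasis n ∅ = 1 := by
  rw [wedgeBasis, ExteriorAlgebra.basis_apply_ofCard _ (Finset.card_empty)]
  simp [ExteriorAlgebra.ιMulti_family]

theorem wedgeBasis_repr_eq_zero {p : ℕ} {a : ExteriorAlgebra ℝ (EuclideanSpace ℝ (Fin n))}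
    (ha : a ∈ ⋀[ℝ]^p (EuclideanSpace ℝ (Fin n))) {s : Finset (Fin n)} (hs : s.card ≠ p) :
    (wedgeBasis n).repr a s = 0 := by
  rw [wedgeBasis, Module.Basis.ExteriorAlgebra, Module.Basis.repr_reindex_apply]
  exact DirectSum.IsInternal.collectedBasis_repr_of_mem_ne _ _ (Ne.symm hs) ha

end Basis

/-! ### Smooth maps into the exterior algebra of the model space -/


/-- The model space `ℝⁿ`. -/
abbrev Model (n : ℕ) : Type := EuclideanSpace ℝ (Fin n)

/-- The exterior algebra of the model space. -/
abbrev Multivec (n : ℕ) : Type := ExteriorAlgebra ℝ (Model n)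

variable {n : ℕ}

/-- All components of `P` are smooth at `y`. -/
def CompSmoothAt (P : Model n → Multivec n) (y : Model n) : Prop :=
  ∀ s : Finset (Fin n), ContDiffAt ℝ ∞ (fun z => (wedgeBasis n).repr (P z) s) y

/-- All components of `α` are smooth at `y`. -/
def DualSmoothAt (α : Model n → (Multivec n →ₗ[ℝ] ℝ)) (y : Model n) : Prop :=
  ∀ s : Finset (Fin n), ContDiffAt ℝ ∞ (fun z => α z (wedgeBasis n s)) y

theorem sum_repr_smul_wedgeBasis (v : Multivec n) :
    ∑ s, (wedgeBasis n).repr v s • wedgeBasis n s = v := (wedgeBasis n).sum_repr v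

theorem apply_eq_sum_repr (α : Multivec n →ₗ[ℝ] ℝ) (v : Multivec n) :
    α v = ∑ s, (wedgeBasis n).repr v s * α (wedgeBasis n s) := by
  conv_lhs => rw [← sum_repr_smul_wedgeBasis v, map_sum]
  exact Finset.sum_congr rfl fun s _ => by rw [map_smul, smul_eq_mul]

theorem CompSmoothAt.congr {P Q : Model n → Multivec n} {y : Model n} (hP : CompSmoothAt P y)
    (h : Q =ᶠ[𝓝 y] P) : CompSmoothAt Q y := fun s =>
  (hP s).congr_of_eventuallyEq (h.mono fun z hz => by simp only [hz])

theorem DualSmoothAt.congr {α β : Model n → (Multivec n →ₗ[ℝ] ℝ)} {y : Model n}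
    (hα : DualSmoothAt α y) (h : β =ᶠ[𝓝 y] α) : DualSmoothAt β y := fun s =>
  (hα s).congr_of_eventuallyEq (h.mono fun z hz => by simp only [hz])

theorem CompSmoothAt.const (v : Multivec n) (y : Model n) : CompSmoothAt (fun _ => v) y :=
  fun _ => contDiffAt_const

theorem CompSmoothAt.add {P Q : Model n → Multivec n} {y : Model n} (hP : CompSmoothAt P y)
    (hQ : CompSmoothAt Q y) : CompSmoothAt (fun z => P z + Q z) y := fun s => by
  simpa using (hP s).add (hQ s)

theorem CompSmoothAt.smul {f : Model n → ℝ} {P : Model n → Multivec n} {y : Model n}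
    (hf : ContDiffAt ℝ ∞ f y) (hP : CompSmoothAt P y) :
    CompSmoothAt (fun z => f z • P z) y := fun s => by
  simpa using hf.mul (hP s)

theorem CompSmoothAt.sum {ι : Type*} (t : Finset ι) {P : ι → Model n → Multivec n} {y : Model n}
    (hP : ∀ i ∈ t, CompSmoothAt (P i) y) : CompSmoothAt (fun z => ∑ i ∈ t, P i z) y := fun s => by
  simpa [Finsupp.finsetSum_apply] using ContDiffAt.sum fun i hi => hP i hi s

theorem DualSmoothAt.apply {α : Model n → (Multivec n →ₗ[ℝ] ℝ)} {P : Model n → Multivec n}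
    {y : Model n} (hα : DualSmoothAt α y) (hP : CompSmoothAt P y) :
    ContDiffAt ℝ ∞ (fun z => α z (P z)) y := by
  rw [show (fun z => α z (P z)) = _ from funext fun z => apply_eq_sum_repr (α z) (P z)]
  exact ContDiffAt.sum fun s _ => (hP s).mul (hα s)

theorem DualSmoothAt.const (α : Multivec n →ₗ[ℝ] ℝ) (y : Model n) :
    DualSmoothAt (fun _ => α) y := fun _ => contDiffAt_const

theorem CompSmoothAt.linear {P : Model n → Multivec n} {y : Model n}
    (T : Multivec n →ₗ[ℝ] Multivec n) (hP : CompSmoothAt P y) :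
    CompSmoothAt (fun z => T (P z)) y := fun s =>
  (DualSmoothAt.const ((wedgeBasis n).coord s ∘ₗ T) y).apply hP

theorem CompSmoothAt.mul {P Q : Model n → Multivec n} {y : Model n}
    (hP : CompSmoothAt P y) (hQ : CompSmoothAt Q y) : CompSmoothAt (fun z => P z * Q z) y := by
  have h : (fun z => P z * Q z) =
      fun z => ∑ s, (wedgeBasis n).repr (P z) s • (wedgeBasis n s * Q z) := by
    funext z
    conv_lhs => rw [← sum_repr_smul_wedgeBasis (P z), Finset.sum_mul]
    simp
  rw [h]
  exact CompSmoothAt.sum _ fun s _ =>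
    CompSmoothAt.smul (hP s) (hQ.linear (LinearMap.mulLeft ℝ (wedgeBasis n s)))

theorem compSmoothAt_ι {v : Model n → Model n} {y : Model n} (hv : ContDiffAt ℝ ∞ v y) :
    CompSmoothAt (fun z => ExteriorAlgebra.ι ℝ (v z)) y := fun s =>
  ((LinearMap.toContinuousLinearMap
    ((wedgeBasis n).coord s ∘ₗ ExteriorAlgebra.ι ℝ)).contDiff.contDiffAt).comp y hv

theorem compSmoothAt_ιMulti {l : ℕ} {v : Model n → Fin l → Model n} {y : Model n}
    (hv : ∀ i, ContDiffAt ℝ ∞ (fun z => v z i) y) :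
    CompSmoothAt (fun z => ExteriorAlgebra.ιMulti ℝ l (v z)) y := by
  induction l with
  | zero =>
    simp only [ExteriorAlgebra.ιMulti_zero_apply]
    exact CompSmoothAt.const _ _
  | succ l ih =>
    simp only [ExteriorAlgebra.ιMulti_succ_apply]
    exact (compSmoothAt_ι (hv 0)).mul (ih fun i => hv i.succ)

/-- On a basis monomial `v₁ ∧ ⋯ ∧ v_l` the induced map gives `A v₁ ∧ ⋯ ∧ A v_l`, so its components
are polynomial in those of `A`. -/
theorem CompSmoothAt.map {A : Model n → Model n →L[ℝ] Model n} {P : Model n → Multivec n}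
    {y : Model n} (hA : ContDiffAt ℝ ∞ A y) (hP : CompSmoothAt P y) :
    CompSmoothAt (fun z => ExteriorAlgebra.map (A z).toLinearMap (P z)) y := by
  have h : (fun z => ExteriorAlgebra.map (A z).toLinearMap (P z)) = fun z =>
      ∑ s, (wedgeBasis n).repr (P z) s • ExteriorAlgebra.map (A z).toLinearMap (wedgeBasis n s) := by
    funext z
    conv_lhs => rw [← sum_repr_smul_wedgeBasis (P z), map_sum]
    simp
  rw [h]
  refine CompSmoothAt.sum _ fun s _ => CompSmoothAt.smul (hP s) ?_
  obtain ⟨v, hv⟩ := exists_wedgeBasis_eq_ιMulti s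
  simp only [hv, ExteriorAlgebra.map_apply_ιMulti]
  exact compSmoothAt_ιMulti fun i => hA.clm_apply contDiffAt_const

theorem DualSmoothAt.comp_mulLeft {α : Model n → (Multivec n →ₗ[ℝ] ℝ)} {P : Model n → Multivec n}
    {y : Model n} (hα : DualSmoothAt α y) (hP : CompSmoothAt P y) :
    DualSmoothAt (fun z => α z ∘ₗ LinearMap.mulLeft ℝ (P z)) y := fun s =>
  hα.apply (hP.mul (CompSmoothAt.const (wedgeBasis n s) y))

/-! ### The exterior derivative on the model space -/

theorem altPart_apply (l : ℕ) (α : Multivec n →ₗ[ℝ] ℝ) (v : Fin l → Model n) :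
    altPart l α v = α (ExteriorAlgebra.ιMulti ℝ l v) := rfl

/-- A finite expansion with constant alternating maps: smoothness into the normed space of
alternating maps becomes smoothness of the scalar components. -/
theorem altPart_eq_sum (l : ℕ) (α : Multivec n →ₗ[ℝ] ℝ) :
    altPart l α = ∑ s, α (wedgeBasis n s) • altPart l ((wedgeBasis n).coord s) := by
  ext v
  simp only [altPart_apply, ContinuousAlternatingMap.sum_apply, ContinuousAlternatingMap.smul_apply,
    smul_eq_mul]
  rw [apply_eq_sum_repr]
  exact Finset.sum_congr rfl fun s _ => mul_comm _ _

theorem DualSmoothAt.altPart {α : Model n → (Multivec n →ₗ[ℝ] ℝ)} {y : Model n}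
    (hα : DualSmoothAt α y) (l : ℕ) : ContDiffAt ℝ ∞ (fun z => altPart l (α z)) y := by
  simp only [altPart_eq_sum l (α _)]
  exact ContDiffAt.sum fun s _ => (hα s).smul contDiffAt_const

/-- The exterior derivative in terms of the partial derivatives of the components. -/
theorem extDerivFlat_apply {α : Model n → (Multivec n →ₗ[ℝ] ℝ)} {y : Model n}
    (hα : DualSmoothAt α y) (v : Multivec n) :
    extDerivFlat α y v = ∑ s, (wedgeBasis n).coord s (CliffordAlgebra.contractLeft
      (fderiv ℝ (fun z => α z (wedgeBasis n s)) y).toLinearMap v) := by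
  -- With `α = ∑ α_s e^s` one has `dα = ∑ dα_s ∧ e^s`, and wedging a form with `λ` on the left is
  -- dual to contracting its argument with `λ`. The identity is checked on decomposable
  -- multivectors.
  suffices h : extDerivFlat α y = ∑ s, (wedgeBasis n).coord s ∘ₗ CliffordAlgebra.contractLeft
      (fderiv ℝ (fun z => α z (wedgeBasis n s)) y).toLinearMap by
    rw [h]; simp
  apply ExteriorAlgebra.lhom_ext
  intro l
  ext v
  simp only [LinearMap.compAlternatingMap_apply, extDerivFlat,
    ExteriorAlgebra.liftAlternating_apply_ιMulti]
  cases l with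
  | zero => simp [LinearMap.sum_apply]
  | succ l =>
    simp only [LinearMap.sum_apply, LinearMap.comp_apply, contractLeft_ιMulti, map_sum, map_smul]
    change extDeriv (fun z => altPart l (α z)) y v = _
    rw [extDeriv_apply ((hα.altPart l).differentiableAt (by simp)), Finset.sum_comm]
    refine Finset.sum_congr rfl fun i _ => ?_
    simp only [altPart_apply]
    rw [show (fun z => α z (ExteriorAlgebra.ιMulti ℝ l (i.removeNth v))) = _ from
      funext fun z => apply_eq_sum_repr (α z) _]
    rw [fderiv_fun_sum fun s _ => ((hα s).differentiableAt (by simp)).const_mul _,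
      sum_apply, Finset.smul_sum]
    refine Finset.sum_congr rfl fun s _ => ?_
    rw [fderiv_const_mul ((hα s).differentiableAt (by simp))]
    simp only [smul_apply, smul_eq_mul, Module.Basis.coord_apply,
      ContinuousLinearMap.coe_coe, zsmul_eq_mul]
    push_cast
    ring

/-- This is `d(fα) = f dα + df ∧ α`, with the wedge by `df` written as contraction of the argument.
-/
theorem extDerivFlat_smul {f : Model n → ℝ} {α : Model n → (Multivec n →ₗ[ℝ] ℝ)} {y : Model n}
    (hf : ContDiffAt ℝ ∞ f y) (hα : DualSmoothAt α y) (v : Multivec n) :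
    extDerivFlat (fun z => f z • α z) y v = f y * extDerivFlat α y v +
      α y (CliffordAlgebra.contractLeft (fderiv ℝ f y).toLinearMap v) := by
  have hfα : DualSmoothAt (fun z => f z • α z) y := fun s => hf.mul (hα s)
  rw [extDerivFlat_apply hfα, extDerivFlat_apply hα, apply_eq_sum_repr (α y), Finset.mul_sum,
    ← Finset.sum_add_distrib]
  refine Finset.sum_congr rfl fun s _ => ?_
  simp only [LinearMap.smul_apply, smul_eq_mul]
  rw [fderiv_fun_mul (hf.differentiableAt (by simp)) ((hα s).differentiableAt (by simp))]
  simp only [ContinuousLinearMap.toLinearMap_add, ContinuousLinearMap.toLinearMap_smul, map_add,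
    map_smul, LinearMap.add_apply, LinearMap.smul_apply, Module.Basis.coord_apply, smul_eq_mul]
  ring

theorem extDerivFlat_add {α β : Model n → (Multivec n →ₗ[ℝ] ℝ)} {y : Model n}
    (hα : DualSmoothAt α y) (hβ : DualSmoothAt β y) (v : Multivec n) :
    extDerivFlat (fun z => α z + β z) y v = extDerivFlat α y v + extDerivFlat β y v := by
  have hαβ : DualSmoothAt (fun z => α z + β z) y := fun s => (hα s).add (hβ s)
  rw [extDerivFlat_apply hαβ, extDerivFlat_apply hα, extDerivFlat_apply hβ,
    ← Finset.sum_add_distrib]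
  refine Finset.sum_congr rfl fun s _ => ?_
  simp only [LinearMap.add_apply]
  rw [fderiv_fun_add ((hα s).differentiableAt (by simp)) ((hβ s).differentiableAt (by simp))]
  simp

theorem extDerivFlat_congr {α β : Model n → (Multivec n →ₗ[ℝ] ℝ)} {y : Model n}
    (h : α =ᶠ[𝓝 y] β) : extDerivFlat α y = extDerivFlat β y := by
  unfold extDerivFlat
  congr 1
  funext l
  cases l with
  | zero => rfl
  | succ l =>
    have : (fun z => altPart l (α z)) =ᶠ[𝓝 y] fun z => altPart l (β z) :=
      h.mono fun z hz => by simp only [hz]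
    simp only [this.extDeriv_eq]

/-- The exterior derivative commutes with pull-backs. -/
theorem extDerivFlat_pullback {α : Model n → (Multivec n →ₗ[ℝ] ℝ)} {τ : Model n → Model n}
    {y : Model n} (hα : DualSmoothAt α (τ y)) (hτ : ContDiffAt ℝ ∞ τ y) :
    extDerivFlat
        (fun z => α (τ z) ∘ₗ (ExteriorAlgebra.map (fderiv ℝ τ z).toLinearMap).toLinearMap) y =
      extDerivFlat α (τ y) ∘ₗ
        (ExteriorAlgebra.map (fderiv ℝ τ y).toLinearMap).toLinearMap := by
  apply ExteriorAlgebra.lhom_ext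
  intro l
  ext v
  simp only [LinearMap.compAlternatingMap_apply, extDerivFlat, LinearMap.comp_apply,
    AlgHom.toLinearMap_apply, ExteriorAlgebra.map_apply_ιMulti,
    ExteriorAlgebra.liftAlternating_apply_ιMulti]
  cases l with
  | zero => rfl
  | succ l =>
    have h : (fun z => altPart l (α (τ z) ∘ₗ
        (ExteriorAlgebra.map (fderiv ℝ τ z).toLinearMap).toLinearMap)) =
        fun z => (altPart l (α (τ z))).compContinuousLinearMap (fderiv ℝ τ z) := by
      funext z
      ext w
      simp only [altPart_apply, ContinuousAlternatingMap.compContinuousLinearMap_apply,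
        LinearMap.comp_apply, AlgHom.toLinearMap_apply, ExteriorAlgebra.map_apply_ιMulti]
      rfl
    change extDeriv _ y v = extDeriv _ (τ y) _
    -- Two derivatives of `τ` are needed: the terms with its second derivative vanish by symmetry.
    -- The last side goal is that `∞` is at least this order.
    rw [h, extDeriv_pullback (r := ∞) 
      ((hα.altPart l).differentiableAt (by simp)) hτ
      (by rw [minSmoothness_of_isRCLikeNormedField]; exact WithTop.coe_le_coe.2 le_top)]
    rfl

/-- The exterior derivative of a smooth form is smooth. -/
theorem DualSmoothAt.extDerivFlat {α : Model n → (Multivec n →ₗ[ℝ] ℝ)} {y : Model n}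
    (hα : ∀ᶠ z in 𝓝 y, DualSmoothAt α z) : DualSmoothAt (extDerivFlat α) y := by
  intro t
  have h : (fun z => HigherAffine.extDerivFlat α z (wedgeBasis n t)) =ᶠ[𝓝 y] fun z =>
      ∑ s, ∑ i : Fin n, fderiv ℝ (fun z => α z (wedgeBasis n s)) z (EuclideanSpace.single i 1) *
        (wedgeBasis n).coord s (CliffordAlgebra.contractLeft
          ((EuclideanSpace.basisFun (Fin n) ℝ).toBasis.coord i) (wedgeBasis n t)) := by
    filter_upwards [hα] with z hz
    rw [extDerivFlat_apply hz]
    refine Finset.sum_congr rfl fun s _ => ?_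
    -- Expanding the differential in the coordinate covectors separates smooth coefficients, the
    -- partial derivatives, from constant contraction numbers.
    have hL : (fderiv ℝ (fun z => α z (wedgeBasis n s)) z).toLinearMap =
        ∑ i : Fin n, fderiv ℝ (fun z => α z (wedgeBasis n s)) z (EuclideanSpace.single i 1) •
          (EuclideanSpace.basisFun (Fin n) ℝ).toBasis.coord i := by
      refine (EuclideanSpace.basisFun (Fin n) ℝ).toBasis.ext fun j => ?_
      simp [LinearMap.sum_apply]
    rw [hL]
    simp [LinearMap.sum_apply]
  refine ContDiffAt.congr_of_eventuallyEq ?_ h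
  refine ContDiffAt.sum fun s _ => ContDiffAt.sum fun i _ => ContDiffAt.mul ?_ contDiffAt_const
  exact ((hα.self_of_nhds s).fderiv_right (m := ∞) (by simp)).clm_apply contDiffAt_const

/-! ### Charts -/

section Charts

theorem map_map_of_comp_eq_id {V V' : Type*} [AddCommGroup V] [Module ℝ V] [AddCommGroup V']
    [Module ℝ V'] (f : V →ₗ[ℝ] V') (g : V' →ₗ[ℝ] V) (h : g ∘ₗ f = LinearMap.id)
    (v : ExteriorAlgebra ℝ V) : ExteriorAlgebra.map g (ExteriorAlgebra.map f v) = v := by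
  have h2 := ExteriorAlgebra.map_comp_map f g
  rw [h, ExteriorAlgebra.map_id] at h2
  exact DFunLike.congr_fun h2 v

variable {n : ℕ} {M : Type*} [TopologicalSpace M] [ChartedSpace (EuclideanSpace ℝ (Fin n)) M]

/-- The change of coordinates from the chart around `x₀` to the chart around `x₁`. -/
noncomputable def coordChange (x₀ x₁ : M) (y : Model n) : Model n :=
  extChartAt (𝓡 n) x₁ ((extChartAt (𝓡 n) x₀).symm y)

theorem eventually_mem_target {x₀ x : M} (hx : x ∈ (extChartAt (𝓡 n) x₀).source) :
    ∀ᶠ y in 𝓝 (extChartAt (𝓡 n) x₀ x), y ∈ (extChartAt (𝓡 n) x₀).target :=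
  extChartAt_target_mem_nhds' ((extChartAt (𝓡 n) x₀).map_source hx)

theorem eventually_of_nhds {x₀ x : M} (hx : x ∈ (extChartAt (𝓡 n) x₀).source) {p : M → Prop}
    (hp : ∀ᶠ x' in 𝓝 x, p x') :
    ∀ᶠ y in 𝓝 (extChartAt (𝓡 n) x₀ x), p ((extChartAt (𝓡 n) x₀).symm y) := by
  refine (continuousAt_extChartAt_symm'' ((extChartAt (𝓡 n) x₀).map_source hx)).eventually ?_
  rwa [(extChartAt (𝓡 n) x₀).left_inv hx]

theorem coordChange_apply {x₀ x₁ x : M} (h₀ : x ∈ (extChartAt (𝓡 n) x₀).source) :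
    coordChange x₀ x₁ (extChartAt (𝓡 n) x₀ x) = extChartAt (𝓡 n) x₁ x := by
  rw [coordChange, (extChartAt (𝓡 n) x₀).left_inv h₀]

/-- The fibres at `φ⁻¹(φ x)` and at `x` are different types. The push-forward lands in the fixed
algebra of the model space, so the equality of base points can be transported by `congrArg`. -/
theorem MultivectorField.inChart_apply (X : MultivectorField n M) {x₀ x : M}
    (hx : x ∈ (extChartAt (𝓡 n) x₀).source) :
    X.inChart x₀ (extChartAt (𝓡 n) x₀ x) = ExteriorAlgebra.map (chartDiff x₀ x) (X x) :=
  congrArg (fun x' => ExteriorAlgebra.map (chartDiff x₀ x') (X x'))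
    ((extChartAt (𝓡 n) x₀).left_inv hx)

/-- Turns a statement near `x` on the manifold into one near its coordinates, with `p` free to
mention both the point and its coordinates. Identities of local representations are then proved at
points and differentiated in the chart. -/
theorem eventually_chart {x₀ x : M} (hx : x ∈ (extChartAt (𝓡 n) x₀).source) {p : Model n → M → Prop}
    (hp : ∀ᶠ x' in 𝓝 x, p (extChartAt (𝓡 n) x₀ x') x') :
    ∀ᶠ y in 𝓝 (extChartAt (𝓡 n) x₀ x), p y ((extChartAt (𝓡 n) x₀).symm y) := by
  filter_upwards [eventually_of_nhds hx hp, eventually_mem_target hx] with y h1 h2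
  rwa [(extChartAt (𝓡 n) x₀).right_inv h2] at h1

theorem MultivectorField.IsSmooth.compSmoothAt {X : MultivectorField n M} (hX : X.IsSmooth)
    {x₀ x : M} (hx : x ∈ (extChartAt (𝓡 n) x₀).source) :
    CompSmoothAt (X.inChart x₀) (extChartAt (𝓡 n) x₀ x) := fun s =>
  (hX x₀ s).contDiffAt (extChartAt_target_mem_nhds' ((extChartAt (𝓡 n) x₀).map_source hx))

theorem FormField.IsSmooth.dualSmoothAt {θ : FormField n M} (hθ : θ.IsSmooth)
    {x₀ x : M} (hx : x ∈ (extChartAt (𝓡 n) x₀).source) :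
    DualSmoothAt (θ.inChart x₀) (extChartAt (𝓡 n) x₀ x) := fun s =>
  (hθ x₀ s).contDiffAt (extChartAt_target_mem_nhds' ((extChartAt (𝓡 n) x₀).map_source hx))

theorem FormField.IsSmooth.add {θ η : FormField n M} (hθ : θ.IsSmooth)
    (hη : η.IsSmooth) : (θ + η).IsSmooth := fun x₀ s => (hθ x₀ s).add (hη x₀ s)

theorem extDer_apply_one (θ : FormField n M) (x : M) : extDer θ x 1 = 0 := by
  rw [extDer, LinearMap.comp_apply, AlgHom.toLinearMap_apply, map_one, extDerivFlat,
    ← ExteriorAlgebra.ιMulti_zero_apply (R := ℝ) (M := Model n) ![],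
    ExteriorAlgebra.liftAlternating_apply_ιMulti]
  rfl

variable [IsManifold (𝓡 n) ∞ M]

theorem contDiffAt_coordChange {x₀ x₁ x : M} (h₀ : x ∈ (extChartAt (𝓡 n) x₀).source)
    (h₁ : x ∈ (extChartAt (𝓡 n) x₁).source) :
    ContDiffAt ℝ ∞ (coordChange x₀ x₁) (extChartAt (𝓡 n) x₀ x) := by
  have h := contDiffWithinAt_ext_coord_change (I := 𝓡 n) (n := ∞) x₁ x₀
    (y := extChartAt (𝓡 n) x₀ x)
    (by
      rw [ext_coord_change_source]
      refine ⟨_, ⟨(chartAt _ x₀).map_source (by simpa using h₀), ?_⟩, rfl⟩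
      simpa [(chartAt _ x₀).left_inv (by simpa using h₀)] using h₁)
  rw [ModelWithCorners.range_eq_univ, contDiffWithinAt_univ] at h
  exact h

theorem mdifferentiableAt_chart {x₀ x : M} (hx : x ∈ (extChartAt (𝓡 n) x₀).source) :
    MDifferentiableAt (𝓡 n) 𝓘(ℝ, EuclideanSpace ℝ (Fin n)) (extChartAt (𝓡 n) x₀) x :=
  (contMDiffAt_extChartAt' (n := ∞) (by simpa using hx)).mdifferentiableAt (by simp)

theorem isInvertible_chartDiff {x₀ x : M} (hx : x ∈ (extChartAt (𝓡 n) x₀).source) :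
    (mfderiv (𝓡 n) 𝓘(ℝ, EuclideanSpace ℝ (Fin n)) (extChartAt (𝓡 n) x₀) x).IsInvertible := by
  have : IsManifold (𝓡 n) 1 M := IsManifold.of_le (n := ∞) (by simp)
  exact isInvertible_mfderiv_extChartAt hx

/-- The inverse of the differential of the chart around `x₀`, on multivectors. -/
noncomputable def chartInv (x₀ x : M) :
    Multivec n →ₐ[ℝ] ExteriorAlgebra ℝ (TangentSpace (𝓡 n) x) :=
  ExteriorAlgebra.map ((mfderiv (𝓡 n) 𝓘(ℝ, EuclideanSpace ℝ (Fin n))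
    (extChartAt (𝓡 n) x₀) x).inverse.toLinearMap :
      EuclideanSpace ℝ (Fin n) →ₗ[ℝ] TangentSpace (𝓡 n) x)

theorem map_chartDiff_chartInv {x₀ x : M} (hx : x ∈ (extChartAt (𝓡 n) x₀).source)
    (v : Multivec n) : ExteriorAlgebra.map (chartDiff x₀ x) (chartInv x₀ x v) = v :=
  map_map_of_comp_eq_id _ _
    (congrArg ContinuousLinearMap.toLinearMap (isInvertible_chartDiff hx).self_comp_inverse) v

theorem chartInv_map_chartDiff {x₀ x : M} (hx : x ∈ (extChartAt (𝓡 n) x₀).source)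
    (v : ExteriorAlgebra ℝ (TangentSpace (𝓡 n) x)) :
    chartInv x₀ x (ExteriorAlgebra.map (chartDiff x₀ x) v) = v :=
  map_map_of_comp_eq_id _ _
    (congrArg ContinuousLinearMap.toLinearMap (isInvertible_chartDiff hx).inverse_comp_self) v

theorem fderiv_coordChange_comp {x₀ x₁ x : M} (h₀ : x ∈ (extChartAt (𝓡 n) x₀).source)
    (h₁ : x ∈ (extChartAt (𝓡 n) x₁).source) :
    (fderiv ℝ (coordChange x₀ x₁) (extChartAt (𝓡 n) x₀ x)).toLinearMap ∘ₗ chartDiff x₀ x =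
      chartDiff x₁ x := by
  have h : (extChartAt (𝓡 n) x₁ : M → Model n) =ᶠ[𝓝 x]
      coordChange x₀ x₁ ∘ extChartAt (𝓡 n) x₀ := by
    filter_upwards [extChartAt_source_mem_nhds' h₀] with x' hx'
    exact (coordChange_apply hx').symm
  rw [chartDiff, chartDiff, h.mfderiv_eq, mfderiv_comp x
    ((contDiffAt_coordChange h₀ h₁).differentiableAt (by simp)).mdifferentiableAt
    (mdifferentiableAt_chart h₀), mfderiv_eq_fderiv]
  rfl

theorem map_fderiv_coordChange {x₀ x₁ x : M} (h₀ : x ∈ (extChartAt (𝓡 n) x₀).source)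
    (h₁ : x ∈ (extChartAt (𝓡 n) x₁).source) (v : ExteriorAlgebra ℝ (TangentSpace (𝓡 n) x)) :
    ExteriorAlgebra.map (fderiv ℝ (coordChange x₀ x₁) (extChartAt (𝓡 n) x₀ x)).toLinearMap
      (ExteriorAlgebra.map (chartDiff x₀ x) v) = ExteriorAlgebra.map (chartDiff x₁ x) v := by
  rw [← fderiv_coordChange_comp h₀ h₁, ← ExteriorAlgebra.map_comp_map]
  rfl

/-- Pulling back by `φ⁻¹` after pushing forward by `φ` is the identity. The base point is kept as
`φ⁻¹ y`, where both differentials have matching types. -/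
theorem FormField.inChart_target (θ : FormField n M) {x₀ : M} {y : Model n}
    (hy : y ∈ (extChartAt (𝓡 n) x₀).target)
    (v : ExteriorAlgebra ℝ (TangentSpace (𝓡 n) ((extChartAt (𝓡 n) x₀).symm y))) :
    θ.inChart x₀ y (ExteriorAlgebra.map (chartDiff x₀ ((extChartAt (𝓡 n) x₀).symm y)) v) =
      θ ((extChartAt (𝓡 n) x₀).symm y) v := by
  have : IsManifold (𝓡 n) 1 M := IsManifold.of_le (n := ∞) (by simp)
  have h := mfderivWithin_extChartAt_symm_comp_mfderiv_extChartAt (I := 𝓡 n) hy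
  rw [ModelWithCorners.range_eq_univ, mfderivWithin_univ] at h
  exact congrArg _ (map_map_of_comp_eq_id _ _ (congrArg ContinuousLinearMap.toLinearMap h) v)

theorem FormField.inChart_apply (θ : FormField n M) {x₀ x : M}
    (hx : x ∈ (extChartAt (𝓡 n) x₀).source) (v : ExteriorAlgebra ℝ (TangentSpace (𝓡 n) x)) :
    θ.inChart x₀ (extChartAt (𝓡 n) x₀ x) (ExteriorAlgebra.map (chartDiff x₀ x) v) = θ x v := by
  have h := fun v => θ.inChart_target ((extChartAt (𝓡 n) x₀).map_source hx) v
  rw [(extChartAt (𝓡 n) x₀).left_inv hx] at h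
  exact h v

theorem FormField.inChart_apply_inChart (θ : FormField n M) (X : MultivectorField n M) {x₀ x : M}
    (hx : x ∈ (extChartAt (𝓡 n) x₀).source) :
    θ.inChart x₀ (extChartAt (𝓡 n) x₀ x) (X.inChart x₀ (extChartAt (𝓡 n) x₀ x)) = θ x (X x) := by
  rw [X.inChart_apply hx, θ.inChart_apply hx]

theorem MultivectorField.inChart_coordChange (X : MultivectorField n M) {x₀ x₁ x : M}
    (h₀ : x ∈ (extChartAt (𝓡 n) x₀).source) (h₁ : x ∈ (extChartAt (𝓡 n) x₁).source) :
    X.inChart x₁ (extChartAt (𝓡 n) x₁ x) =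
      ExteriorAlgebra.map (fderiv ℝ (coordChange x₀ x₁) (extChartAt (𝓡 n) x₀ x)).toLinearMap
        (X.inChart x₀ (extChartAt (𝓡 n) x₀ x)) := by
  rw [X.inChart_apply h₀, X.inChart_apply h₁, map_fderiv_coordChange h₀ h₁]

theorem FormField.inChart_coordChange (θ : FormField n M) {x₀ x₁ x : M}
    (h₀ : x ∈ (extChartAt (𝓡 n) x₀).source) (h₁ : x ∈ (extChartAt (𝓡 n) x₁).source) :
    θ.inChart x₀ (extChartAt (𝓡 n) x₀ x) =
      θ.inChart x₁ (extChartAt (𝓡 n) x₁ x) ∘ₗ (ExteriorAlgebra.map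
        (fderiv ℝ (coordChange x₀ x₁) (extChartAt (𝓡 n) x₀ x)).toLinearMap).toLinearMap := by
  refine LinearMap.ext fun w => ?_
  rw [← map_chartDiff_chartInv h₀ w, θ.inChart_apply h₀, LinearMap.comp_apply,
    AlgHom.toLinearMap_apply, map_fderiv_coordChange h₀ h₁, θ.inChart_apply h₁]

/-! ### Smoothness -/

/-- Components transform by the differential of the transition map, which is smooth. It goes from
`x₀` to `x₁`, hence is evaluated at the `x₀`-coordinates of the point with `x₁`-coordinates `w`. -/
theorem compSmoothAt_of_chart {X : MultivectorField n M} {x₀ x₁ x : M}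
    (h₀ : x ∈ (extChartAt (𝓡 n) x₀).source) (h₁ : x ∈ (extChartAt (𝓡 n) x₁).source)
    (h : CompSmoothAt (X.inChart x₀) (extChartAt (𝓡 n) x₀ x)) :
    CompSmoothAt (X.inChart x₁) (extChartAt (𝓡 n) x₁ x) := by
  have hσ := contDiffAt_coordChange h₁ h₀
  have hA : ContDiffAt ℝ ∞ (fun w => fderiv ℝ (coordChange x₀ x₁) (coordChange x₁ x₀ w))
      (extChartAt (𝓡 n) x₁ x) := by
    refine ContDiffAt.comp (g := fderiv ℝ (coordChange x₀ x₁)) _ ?_ hσ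
    rw [coordChange_apply h₁]
    exact (contDiffAt_coordChange h₀ h₁).fderiv_right (by simp)
  have hP : CompSmoothAt (fun w => X.inChart x₀ (coordChange x₁ x₀ w))
      (extChartAt (𝓡 n) x₁ x) := fun s => by
    refine ContDiffAt.comp (g := fun z => (wedgeBasis n).repr (X.inChart x₀ z) s) _ ?_ hσ
    rw [coordChange_apply h₁]
    exact h s
  refine (CompSmoothAt.map hA hP).congr ?_
  refine eventually_chart h₁ (p := fun w _ => X.inChart x₁ w = ExteriorAlgebra.map
    (fderiv ℝ (coordChange x₀ x₁) (coordChange x₁ x₀ w)).toLinearMap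
      (X.inChart x₀ (coordChange x₁ x₀ w))) ?_
  filter_upwards [extChartAt_source_mem_nhds' h₀, extChartAt_source_mem_nhds' h₁] with x' h0 h1
  rw [coordChange_apply h1, ← X.inChart_coordChange h0 h1]

theorem dualSmoothAt_of_chart {θ : FormField n M} {x₀ x₁ x : M}
    (h₀ : x ∈ (extChartAt (𝓡 n) x₀).source) (h₁ : x ∈ (extChartAt (𝓡 n) x₁).source)
    (h : DualSmoothAt (θ.inChart x₀) (extChartAt (𝓡 n) x₀ x)) :
    DualSmoothAt (θ.inChart x₁) (extChartAt (𝓡 n) x₁ x) := by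
  have hτ := contDiffAt_coordChange h₁ h₀
  have hα : DualSmoothAt (fun w => θ.inChart x₀ (coordChange x₁ x₀ w))
      (extChartAt (𝓡 n) x₁ x) := fun s => by
    refine ContDiffAt.comp (g := fun z => θ.inChart x₀ z (wedgeBasis n s)) _ ?_ hτ
    rw [coordChange_apply h₁]
    exact h s
  have hβ : DualSmoothAt (fun w => θ.inChart x₀ (coordChange x₁ x₀ w) ∘ₗ (ExteriorAlgebra.map
      (fderiv ℝ (coordChange x₁ x₀) w).toLinearMap).toLinearMap) (extChartAt (𝓡 n) x₁ x) :=
    fun s => hα.apply (CompSmoothAt.map (hτ.fderiv_right (by simp)) (CompSmoothAt.const _ _))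
  refine hβ.congr ?_
  refine eventually_chart h₁ (p := fun w _ => θ.inChart x₁ w =
    θ.inChart x₀ (coordChange x₁ x₀ w) ∘ₗ (ExteriorAlgebra.map
      (fderiv ℝ (coordChange x₁ x₀) w).toLinearMap).toLinearMap) ?_
  filter_upwards [extChartAt_source_mem_nhds' h₀, extChartAt_source_mem_nhds' h₁] with x' h0 h1
  rw [coordChange_apply h1, ← θ.inChart_coordChange h1 h0]

/-- One chart per point suffices, and it may be chosen to suit the point. -/
theorem MultivectorField.isSmooth_of_compSmoothAt {X : MultivectorField n M}
    (h : ∀ x, ∃ x₀, x ∈ (extChartAt (𝓡 n) x₀).source ∧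
      CompSmoothAt (X.inChart x₀) (extChartAt (𝓡 n) x₀ x)) : X.IsSmooth := by
  intro x₁ s y hy
  obtain ⟨x₀, h₀, hs⟩ := h ((extChartAt (𝓡 n) x₁).symm y)
  have := compSmoothAt_of_chart h₀ ((extChartAt (𝓡 n) x₁).map_target hy) hs s
  rw [(extChartAt (𝓡 n) x₁).right_inv hy] at this
  exact this.contDiffWithinAt

theorem FormField.isSmooth_of_dualSmoothAt {θ : FormField n M}
    (h : ∀ x, ∃ x₀, x ∈ (extChartAt (𝓡 n) x₀).source ∧
      DualSmoothAt (θ.inChart x₀) (extChartAt (𝓡 n) x₀ x)) : θ.IsSmooth := by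
  intro x₁ s y hy
  obtain ⟨x₀, h₀, hs⟩ := h ((extChartAt (𝓡 n) x₁).symm y)
  have := dualSmoothAt_of_chart h₀ ((extChartAt (𝓡 n) x₁).map_target hy) hs s
  rw [(extChartAt (𝓡 n) x₁).right_inv hy] at this
  exact this.contDiffWithinAt

theorem IsSmoothFun.contDiffAt {f : M → ℝ} (hf : IsSmoothFun n f) {x₀ x : M}
    (hx : x ∈ (extChartAt (𝓡 n) x₀).source) :
    ContDiffAt ℝ ∞ (fun y => f ((extChartAt (𝓡 n) x₀).symm y)) (extChartAt (𝓡 n) x₀ x) := by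
  rw [← contMDiffAt_iff_contDiffAt]
  exact (ContMDiff.contMDiffAt hf).comp _ ((contMDiffOn_extChartAt_symm x₀).contMDiffAt
    (extChartAt_target_mem_nhds' ((extChartAt (𝓡 n) x₀).map_source hx)))

theorem MultivectorField.IsSmooth.add {X Y : MultivectorField n M} (hX : X.IsSmooth)
    (hY : Y.IsSmooth) : (X + Y).IsSmooth :=
  MultivectorField.isSmooth_of_compSmoothAt fun x => ⟨x, mem_extChartAt_source x, by
    refine ((hX.compSmoothAt (mem_extChartAt_source x)).add
      (hY.compSmoothAt (mem_extChartAt_source x))).congr (.of_forall fun y => ?_)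
    exact map_add _ _ _⟩

theorem MultivectorField.IsSmooth.mul {X Y : MultivectorField n M} (hX : X.IsSmooth)
    (hY : Y.IsSmooth) : (X * Y).IsSmooth :=
  MultivectorField.isSmooth_of_compSmoothAt fun x => ⟨x, mem_extChartAt_source x, by
    refine ((hX.compSmoothAt (mem_extChartAt_source x)).mul
      (hY.compSmoothAt (mem_extChartAt_source x))).congr (.of_forall fun y => ?_)
    exact map_mul _ _ _⟩

theorem MultivectorField.IsSmooth.smul {X : MultivectorField n M} {f : M → ℝ}
    (hf : IsSmoothFun n f) (hX : X.IsSmooth) : (f • X).IsSmooth :=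
  MultivectorField.isSmooth_of_compSmoothAt fun x => ⟨x, mem_extChartAt_source x, by
    refine (CompSmoothAt.smul (hf.contDiffAt (mem_extChartAt_source x))
      (hX.compSmoothAt (mem_extChartAt_source x))).congr (.of_forall fun y => ?_)
    exact (ExteriorAlgebra.map _).toLinearMap.map_smul _ _⟩

theorem MultivectorField.isSmooth_zero : (0 : MultivectorField n M).IsSmooth :=
  MultivectorField.isSmooth_of_compSmoothAt fun x => ⟨x, mem_extChartAt_source x, by
    refine (CompSmoothAt.const 0 _).congr (.of_forall fun y => ?_)
    exact map_zero _⟩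

theorem FormField.IsSmooth.smul {θ : FormField n M} {f : M → ℝ} (hf : IsSmoothFun n f)
    (hθ : θ.IsSmooth) : (f • θ).IsSmooth :=
  FormField.isSmooth_of_dualSmoothAt fun x => ⟨x, mem_extChartAt_source x, fun s =>
    (hf.contDiffAt (mem_extChartAt_source x)).mul
      (hθ.dualSmoothAt (mem_extChartAt_source x) s)⟩

theorem inChart_interior (X : MultivectorField n M) (θ : FormField n M) {x₀ x : M}
    (hx : x ∈ (extChartAt (𝓡 n) x₀).source) :
    (interior X θ).inChart x₀ (extChartAt (𝓡 n) x₀ x) =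
      θ.inChart x₀ (extChartAt (𝓡 n) x₀ x) ∘ₗ
        LinearMap.mulLeft ℝ (X.inChart x₀ (extChartAt (𝓡 n) x₀ x)) := by
  refine LinearMap.ext fun w => ?_
  rw [← map_chartDiff_chartInv hx w, FormField.inChart_apply _ hx, LinearMap.comp_apply,
    LinearMap.mulLeft_apply, X.inChart_apply hx, ← map_mul, θ.inChart_apply hx]
  rfl

theorem FormField.IsSmooth.interior {X : MultivectorField n M} {θ : FormField n M}
    (hX : X.IsSmooth) (hθ : θ.IsSmooth) : (HigherAffine.interior X θ).IsSmooth :=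
  FormField.isSmooth_of_dualSmoothAt fun x => ⟨x, mem_extChartAt_source x, by
    refine ((hθ.dualSmoothAt (mem_extChartAt_source x)).comp_mulLeft
      (hX.compSmoothAt (mem_extChartAt_source x))).congr ?_
    refine eventually_chart (mem_extChartAt_source x) (p := fun y (_ : M) =>
      (HigherAffine.interior X θ).inChart x y =
        θ.inChart x y ∘ₗ LinearMap.mulLeft ℝ (X.inChart x y)) ?_
    filter_upwards [extChartAt_source_mem_nhds' (I := 𝓡 n) (mem_extChartAt_source x)] with x' hx'
    exact inChart_interior X θ hx'⟩

/-- `extDer` uses a chart that varies with the point. Naturality of `d` under the transition map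
allows a fixed chart, without which smoothness of `dθ` could not be read off. -/
theorem extDer_apply {θ : FormField n M} (hθ : θ.IsSmooth) {x₀ x : M}
    (hx : x ∈ (extChartAt (𝓡 n) x₀).source) (v : ExteriorAlgebra ℝ (TangentSpace (𝓡 n) x)) :
    extDer θ x v = extDerivFlat (θ.inChart x₀) (extChartAt (𝓡 n) x₀ x)
      (ExteriorAlgebra.map (chartDiff x₀ x) v) := by
  have hxx := mem_extChartAt_source (I := 𝓡 n) x
  have h : θ.inChart x =ᶠ[𝓝 (extChartAt (𝓡 n) x x)] fun z =>
      θ.inChart x₀ (coordChange x x₀ z) ∘ₗ (ExteriorAlgebra.map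
        (fderiv ℝ (coordChange x x₀) z).toLinearMap).toLinearMap := by
    refine eventually_chart hxx (p := fun w _ => θ.inChart x w =
      θ.inChart x₀ (coordChange x x₀ w) ∘ₗ (ExteriorAlgebra.map
        (fderiv ℝ (coordChange x x₀) w).toLinearMap).toLinearMap) ?_
    filter_upwards [extChartAt_source_mem_nhds' hx, extChartAt_source_mem_nhds' hxx] with x' h0 h1
    rw [coordChange_apply h1, ← θ.inChart_coordChange h1 h0]
  rw [extDer, LinearMap.comp_apply, extDerivFlat_congr h, extDerivFlat_pullback
    (by rw [coordChange_apply hxx]; exact hθ.dualSmoothAt hx) (contDiffAt_coordChange hxx hx),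
    LinearMap.comp_apply, coordChange_apply hxx]
  simp only [AlgHom.toLinearMap_apply]
  rw [map_fderiv_coordChange hxx hx]

theorem contDiffAt_extDer {θ : FormField n M} (hθ : θ.IsSmooth) {X : MultivectorField n M}
    (hX : X.IsSmooth) {x₀ x : M} (hx : x ∈ (extChartAt (𝓡 n) x₀).source) :
    ContDiffAt ℝ ∞ (fun y => extDer θ ((extChartAt (𝓡 n) x₀).symm y)
      (X ((extChartAt (𝓡 n) x₀).symm y))) (extChartAt (𝓡 n) x₀ x) := by
  have hd : ∀ᶠ z in 𝓝 (extChartAt (𝓡 n) x₀ x), DualSmoothAt (θ.inChart x₀) z := by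
    refine eventually_chart hx (p := fun z _ => DualSmoothAt (θ.inChart x₀) z) ?_
    filter_upwards [extChartAt_source_mem_nhds' hx] with x' hx'
    exact hθ.dualSmoothAt hx'
  refine ((DualSmoothAt.extDerivFlat hd).apply (hX.compSmoothAt hx)).congr_of_eventuallyEq ?_
  refine eventually_chart hx (p := fun y x' => extDer θ x' (X x') =
    extDerivFlat (θ.inChart x₀) y (X.inChart x₀ y)) ?_
  filter_upwards [extChartAt_source_mem_nhds' hx] with x' hx'
  rw [extDer_apply hθ hx', X.inChart_apply hx']

theorem contDiffAt_formField_apply {θ : FormField n M} (hθ : θ.IsSmooth)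
    {X : MultivectorField n M} (hX : X.IsSmooth) {x₀ x : M}
    (hx : x ∈ (extChartAt (𝓡 n) x₀).source) :
    ContDiffAt ℝ ∞ (fun y => θ ((extChartAt (𝓡 n) x₀).symm y)
      (X ((extChartAt (𝓡 n) x₀).symm y))) (extChartAt (𝓡 n) x₀ x) := by
  refine ((hθ.dualSmoothAt hx).apply (hX.compSmoothAt hx)).congr_of_eventuallyEq ?_
  refine eventually_chart hx (p := fun y x' => θ x' (X x') = θ.inChart x₀ y (X.inChart x₀ y)) ?_
  filter_upwards [extChartAt_source_mem_nhds' hx] with x' hx'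
  rw [θ.inChart_apply_inChart X hx']

end Charts

/-! ### Homogeneous fields and forms -/

section Homogeneous

theorem eq_zero_of_mem_extPow_neg {V : Type*} [AddCommGroup V] [Module ℝ V] {m : ℤ} (hm : m < 0)
    {v : ExteriorAlgebra ℝ V} (hv : v ∈ extPow V m) : v = 0 := by
  cases m with
  | ofNat m => exact absurd hm (by simp)
  | negSucc m => simpa [extPow] using hv

theorem wedgeBasis_repr_eq_zero_of_mem_extPow {n : ℕ} {m : ℤ} {a : Multivec n}
    (ha : a ∈ extPow (Model n) m) {s : Finset (Fin n)} (hs : (s.card : ℤ) ≠ m) :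
    (wedgeBasis n).repr a s = 0 := by
  rcases lt_or_ge m 0 with hm | hm
  · rw [eq_zero_of_mem_extPow_neg hm ha]; simp
  · lift m to ℕ using hm
    exact wedgeBasis_repr_eq_zero ha (by exact_mod_cast hs)

variable {n : ℕ} {M : Type*} [TopologicalSpace M] [ChartedSpace (EuclideanSpace ℝ (Fin n)) M]

theorem isSmoothFun_const (c : ℝ) : IsSmoothFun n (fun _ : M => c) := contMDiff_const

theorem FormField.IsForm.add {l : ℤ} {θ η : FormField n M} (hθ : θ.IsForm l) (hη : η.IsForm l) :
    (θ + η).IsForm l :=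
  ⟨hθ.1.add hη.1, fun x m hm v hv => by
    simp [hθ.2 x m hm v hv, hη.2 x m hm v hv]⟩

/-! ### Local frames -/

/-- A bump function around `x₀`. -/
noncomputable def bump (x₀ : M) : SmoothBumpFunction (𝓡 n) x₀ :=
  Classical.arbitrary _

theorem bump_self (x : M) : bump (n := n) x x = 1 := (bump (n := n) x).eq_one

theorem mem_source_of_mem_tsupport [T2Space M] {x₀ x : M} (hx : x ∈ tsupport (bump (n := n) x₀)) :
    x ∈ (extChartAt (𝓡 n) x₀).source :=
  (bump (n := n) x₀).tsupport_subset_extChartAt_source hx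

variable (n) in
/-- The coordinate multivector field `∂_s` of the chart around `x₀`, cut off by a bump function. -/
noncomputable def frameField (x₀ : M) (s : Finset (Fin n)) : MultivectorField n M := fun x =>
  bump (n := n) x₀ x • chartInv x₀ x (wedgeBasis n s)

theorem frameField_self (x : M) (s : Finset (Fin n)) :
    frameField n x s x = chartInv x x (wedgeBasis n s) := by
  rw [frameField, bump_self, one_smul]

variable [IsManifold (𝓡 n) ∞ M]

theorem MultivectorField.IsKVector.add {m : ℤ} {X Y : MultivectorField n M} (hX : X.IsKVector m)
    (hY : Y.IsKVector m) : (X + Y).IsKVector m :=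
  ⟨hX.1.add hY.1, fun x => add_mem (hX.2 x) (hY.2 x)⟩

theorem MultivectorField.IsKVector.smul {m : ℤ} {X : MultivectorField n M} {f : M → ℝ}
    (hf : IsSmoothFun n f) (hX : X.IsKVector m) : (f • X).IsKVector m :=
  ⟨.smul hf hX.1, fun x => Submodule.smul_mem _ _ (hX.2 x)⟩

theorem MultivectorField.isKVector_zero (m : ℤ) : (0 : MultivectorField n M).IsKVector m :=
  ⟨isSmooth_zero, fun _ => zero_mem _⟩

theorem MultivectorField.IsKVector.mul {p q : ℤ} {X Y : MultivectorField n M}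
    (hX : X.IsKVector p) (hY : Y.IsKVector q) : (X * Y).IsKVector (p + q) :=
  ⟨hX.1.mul hY.1, fun x => mul_mem_extPow (hX.2 x) (hY.2 x)⟩

theorem MultivectorField.isKVector_sum {m : ℤ} {ι : Type*} (t : Finset ι)
    {X : ι → MultivectorField n M} (hX : ∀ i ∈ t, (X i).IsKVector m) :
    (∑ i ∈ t, X i).IsKVector m := by
  classical
  induction t using Finset.induction_on with
  | empty => simpa using MultivectorField.isKVector_zero m
  | insert a t ha ih =>
    rw [Finset.sum_insert ha]
    exact (hX a (by simp)).add (ih fun i hi => hX i (by simp [hi]))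

theorem FormField.IsForm.smul {l : ℤ} {θ : FormField n M} {f : M → ℝ} (hf : IsSmoothFun n f)
    (hθ : θ.IsForm l) : (f • θ).IsForm l :=
  ⟨.smul hf hθ.1, fun x m hm v hv => by simp [hθ.2 x m hm v hv]⟩

theorem FormField.isForm_zero (l : ℤ) : (0 : FormField n M).IsForm l :=
  ⟨FormField.isSmooth_of_dualSmoothAt fun x => ⟨x, mem_extChartAt_source x,
    DualSmoothAt.const 0 _⟩, fun _ _ _ _ _ => rfl⟩

theorem FormField.IsForm.interior {j l : ℤ} {X : MultivectorField n M} {θ : FormField n M}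
    (hX : X.IsKVector j) (hθ : θ.IsForm l) : (HigherAffine.interior X θ).IsForm (l - j) :=
  ⟨.interior hX.1 hθ.1, fun x m hm v hv => by
    change θ x (X x * v) = 0
    exact hθ.2 x (j + m) (by omega) _ (mul_mem_extPow (hX.2 x) hv)⟩

theorem frameField_inChart {x₀ x : M} (s : Finset (Fin n))
    (hx : x ∈ (extChartAt (𝓡 n) x₀).source) :
    (frameField n x₀ s).inChart x₀ (extChartAt (𝓡 n) x₀ x) =
      bump (n := n) x₀ x • wedgeBasis n s := by
  rw [MultivectorField.inChart_apply _ hx, frameField]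
  refine ((ExteriorAlgebra.map _).toLinearMap.map_smul _ _).trans ?_
  exact congrArg _ (map_chartDiff_chartInv hx _)

variable [T2Space M]

theorem isSmoothFun_bump (x₀ : M) : IsSmoothFun n (bump (n := n) x₀) :=
  (bump (n := n) x₀).contMDiff

theorem frameField_isKVector (x₀ : M) (s : Finset (Fin n)) :
    (frameField n x₀ s).IsKVector s.card := by
  refine ⟨MultivectorField.isSmooth_of_compSmoothAt fun x => ?_, fun x => ?_⟩
  · by_cases hx : x ∈ (extChartAt (𝓡 n) x₀).source
    · refine ⟨x₀, hx, ?_⟩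
      refine (CompSmoothAt.smul ((isSmoothFun_bump x₀).contDiffAt hx)
        (CompSmoothAt.const (wedgeBasis n s) _)).congr ?_
      refine eventually_chart hx (p := fun y x' => (frameField n x₀ s).inChart x₀ y =
        bump (n := n) x₀ x' • wedgeBasis n s) ?_
      filter_upwards [extChartAt_source_mem_nhds' hx] with x' hx'
      exact frameField_inChart s hx'
    -- The support of the bump function lies inside the chart domain, so outside that domain the
    -- field vanishes on a whole neighbourhood.
    · refine ⟨x, mem_extChartAt_source x, (CompSmoothAt.const 0 _).congr ?_⟩
      refine eventually_chart (mem_extChartAt_source x) (p := fun y (_ : M) =>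
        (frameField n x₀ s).inChart x y = 0) ?_
      have h0 := notMem_tsupport_iff_eventuallyEq.1 (mt mem_source_of_mem_tsupport hx)
      filter_upwards [extChartAt_source_mem_nhds' (I := 𝓡 n) (mem_extChartAt_source x), h0]
        with x' hx' h0'
      rw [MultivectorField.inChart_apply _ hx', frameField, h0']
      exact (congrArg _ (zero_smul _ _)).trans (map_zero _)
  · exact Submodule.smul_mem _ _ (map_mem_extPow _ (wedgeBasis_mem s))

/-- Forms of degree `m` are determined by their values on `m`-vector fields. -/
theorem FormField.IsForm.ext {m : ℤ} {η η' : FormField n M} (h : η.IsForm m) (h' : η'.IsForm m)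
    (he : ∀ Y : MultivectorField n M, Y.IsKVector m → ∀ x, η x (Y x) = η' x (Y x)) : η = η' := by
  funext x
  -- In degree `m` the basis multivectors at `x` are values of global frame fields; in all other
  -- degrees both forms vanish.
  have key : η x ∘ₗ (chartInv x x).toLinearMap = η' x ∘ₗ (chartInv x x).toLinearMap := by
    refine (wedgeBasis n).ext fun s => ?_
    simp only [LinearMap.comp_apply, AlgHom.toLinearMap_apply]
    by_cases hs : (s.card : ℤ) = m
    · rw [← frameField_self]
      exact he _ (hs ▸ frameField_isKVector x s) x
    · have hm := map_mem_extPow ((mfderiv (𝓡 n) 𝓘(ℝ, EuclideanSpace ℝ (Fin n))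
        (extChartAt (𝓡 n) x) x).inverse.toLinearMap :
          EuclideanSpace ℝ (Fin n) →ₗ[ℝ] TangentSpace (𝓡 n) x) (p := (s.card : ℤ))
          (wedgeBasis_mem s)
      exact (h.2 x _ hs _ hm).trans (h'.2 x _ hs _ hm).symm
  refine LinearMap.ext fun v => ?_
  rw [← chartInv_map_chartDiff (mem_extChartAt_source x) v]
  exact DFunLike.congr_fun key _

theorem FormField.IsForm.eq_zero {m : ℤ} (hm : m < 0) {η : FormField n M} (h : η.IsForm m) :
    η = 0 :=
  h.ext (FormField.isForm_zero m) fun Y hY x => by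
    rw [eq_zero_of_mem_extPow_neg hm (hY.2 x), map_zero, map_zero]

/-- The components of a multivector field in the chart around `x₀`, cut off by a bump function. -/
noncomputable def cutoffCoord (Y : MultivectorField n M) (x₀ : M) (s : Finset (Fin n)) : M → ℝ :=
  fun x => bump (n := n) x₀ x *
    (wedgeBasis n).repr (Y.inChart x₀ (extChartAt (𝓡 n) x₀ x)) s

theorem isSmoothFun_cutoffCoord {Y : MultivectorField n M} (hY : Y.IsSmooth) (x₀ : M)
    (s : Finset (Fin n)) : IsSmoothFun n (cutoffCoord Y x₀ s) := by
  refine contMDiff_of_tsupport fun x hx => ?_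
  have hx' : x ∈ (extChartAt (𝓡 n) x₀).source :=
    mem_source_of_mem_tsupport (tsupport_mul_subset_left hx)
  refine ((isSmoothFun_bump x₀).contMDiffAt).mul ?_
  exact (contMDiffAt_iff_contDiffAt.2 (hY.compSmoothAt hx' s)).comp x
    (contMDiffAt_extChartAt' (by simpa using hx'))

/-- The bump function enters twice: one factor makes the coefficients global smooth functions, the
other makes the coordinate multivectors global fields. Linearity over globally defined functions
then applies to every summand. -/
theorem bump_sq_smul_eq_sum {m : ℤ} {Y : MultivectorField n M} (hY : Y.IsKVector m) (x₀ : M) :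
    ((fun x => bump (n := n) x₀ x * bump (n := n) x₀ x) : M → ℝ) • Y =
      ∑ s : Finset (Fin n) with (s.card : ℤ) = m, cutoffCoord Y x₀ s • frameField n x₀ s := by
  funext x
  rw [Finset.sum_apply]
  simp only [Pi.smul_apply', cutoffCoord, frameField, smul_smul]
  by_cases hx : x ∈ (extChartAt (𝓡 n) x₀).source
  · conv_lhs => rw [← chartInv_map_chartDiff hx (Y x), ← Y.inChart_apply hx,
      ← sum_repr_smul_wedgeBasis (Y.inChart x₀ _), map_sum, Finset.smul_sum]
    refine (Finset.sum_subset (Finset.subset_univ _) fun s _ hs => ?_).symm.trans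
      (Finset.sum_congr rfl fun s _ => ?_)
    · rw [wedgeBasis_repr_eq_zero_of_mem_extPow (m := m) _ (by simpa using hs)]
      · simp
      · rw [Y.inChart_apply hx]
        exact map_mem_extPow _ (hY.2 x)
    · rw [map_smul, smul_smul]
      congr 1
      ring
  · have h0 : bump (n := n) x₀ x = 0 :=
      image_eq_zero_of_notMem_tsupport (mt mem_source_of_mem_tsupport hx)
    simp [h0]

end Homogeneous

/-! ### The Leibniz rules -/

section Leibniz

variable {n : ℕ} {M : Type*} [TopologicalSpace M] [ChartedSpace (EuclideanSpace ℝ (Fin n)) M]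

theorem neg_one_zpow_congr {a b : ℤ} (h : Even (a - b)) : (-1 : ℝ) ^ a = (-1) ^ b := by
  have : (-1 : ℝ) ^ a = (-1) ^ (a - b) * (-1) ^ b := by
    rw [← zpow_add₀ (by norm_num), sub_add_cancel]
  rw [this, h.neg_one_zpow, one_mul]

/-- An exterior derivative has no part of degree `0`, so `d i_X θ` contributes nothing and `X`
enters without being differentiated. -/
theorem lieDer_apply_one (k : ℤ) (X : MultivectorField n M) (θ : FormField n M) (x : M) :
    lieDer k X θ x 1 = -((-1 : ℝ) ^ k * extDer θ x (X x)) := by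
  change extDer (interior X θ) x 1 - (-1 : ℝ) ^ k * extDer θ x (X x * 1) = _
  rw [extDer_apply_one, mul_one, zero_sub]

theorem ofFun_inChart (f : M → ℝ) (x₀ : M) (y : Model n) :
    (ofFun n f).inChart x₀ y = f ((extChartAt (𝓡 n) x₀).symm y) • wedgeBasis n ∅ := by
  rw [wedgeBasis_empty, ← Algebra.algebraMap_eq_smul_one]
  exact AlgHom.commutes _ _

theorem partialDeriv_ofFun (f : M → ℝ) (x₀ : M) (i : Fin n) (y : Model n) :
    partialDeriv i ((ofFun n f).inChart x₀) y =
      algebraMap ℝ (Multivec n) (fderiv ℝ (fun z => f ((extChartAt (𝓡 n) x₀).symm z)) y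
        (EuclideanSpace.single i 1)) := by
  rw [partialDeriv, Finset.sum_eq_single ∅]
  · simp only [ofFun_inChart, map_smul, Module.Basis.repr_self]
    simp [wedgeBasis_empty, Algebra.algebraMap_eq_smul_one]
  · intro s _ hs
    simp only [ofFun_inChart, map_smul, Module.Basis.repr_self]
    simp [hs.symm]
  · simp

variable [IsManifold (𝓡 n) ∞ M]

/-- A function contracts to zero, which removes the half of the bracket that differentiates `X`; the
remaining sum of partial derivatives assembles `df`. -/
theorem schouten_ofFun_inChart (k : ℤ) (X : MultivectorField n M) (f : M → ℝ)
    (x : M) :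
    (schouten k 0 X (ofFun n f)).inChart x (extChartAt (𝓡 n) x x) =
      CliffordAlgebra.contractRight (X.inChart x (extChartAt (𝓡 n) x x))
        (fderiv ℝ (fun z => f ((extChartAt (𝓡 n) x).symm z)) (extChartAt (𝓡 n) x x)).toLinearMap := by
  have hxx := mem_extChartAt_source (I := 𝓡 n) x
  set y := extChartAt (𝓡 n) x x with hy
  have hL : (fderiv ℝ (fun z => f ((extChartAt (𝓡 n) x).symm z)) y).toLinearMap =
      ∑ i : Fin n, fderiv ℝ (fun z => f ((extChartAt (𝓡 n) x).symm z)) y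
        (EuclideanSpace.single i 1) • (EuclideanSpace.basisFun (Fin n) ℝ).toBasis.coord i := by
    refine (EuclideanSpace.basisFun (Fin n) ℝ).toBasis.ext fun j => ?_
    simp [LinearMap.sum_apply]
  rw [hy, MultivectorField.inChart_apply _ hxx, schouten]
  refine (map_chartDiff_chartInv hxx _).trans ?_
  rw [← hy, hL, map_sum]
  refine Finset.sum_congr rfl fun i _ => ?_
  have h0 : contractCoord i ((ofFun n f).inChart x y) = 0 := by
    rw [ofFun_inChart, wedgeBasis_empty, ← Algebra.algebraMap_eq_smul_one]
    exact CliffordAlgebra.contractRight_algebraMap (Q := (0 : QuadraticForm ℝ (Model n))) _ _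
  rw [partialDeriv_ofFun f x i y, h0, zero_mul, smul_zero, sub_zero, ← Algebra.commutes,
    ← Algebra.smul_def, map_smul]
  rfl

/-- The extra term is `(df ∧ θ)(X)`, left in the chart so that it can be compared with
`schouten_ofFun_inChart`. -/
theorem extDer_smul {f : M → ℝ} (hf : IsSmoothFun n f) {θ : FormField n M} (hθ : θ.IsSmooth)
    (X : MultivectorField n M) (x : M) :
    extDer (f • θ) x (X x) = f x * extDer θ x (X x) +
      θ.inChart x (extChartAt (𝓡 n) x x) (CliffordAlgebra.contractLeft
        (fderiv ℝ (fun z => f ((extChartAt (𝓡 n) x).symm z)) (extChartAt (𝓡 n) x x)).toLinearMap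
        (X.inChart x (extChartAt (𝓡 n) x x))) := by
  have hxx := mem_extChartAt_source (I := 𝓡 n) x
  rw [extDer_apply (.smul hf hθ) hxx, extDer_apply hθ hxx, X.inChart_apply hxx]
  have h := extDerivFlat_smul (hf.contDiffAt hxx) (hθ.dualSmoothAt hxx)
    (ExteriorAlgebra.map (chartDiff x x) (X x))
  simp only [(extChartAt (𝓡 n) x).left_inv hxx] at h
  exact h

theorem extDer_add {θ η : FormField n M} (hθ : θ.IsSmooth) (hη : η.IsSmooth) (x : M)
    (v : ExteriorAlgebra ℝ (TangentSpace (𝓡 n) x)) :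
    extDer (θ + η) x v = extDer θ x v + extDer η x v := by
  have hxx := mem_extChartAt_source (I := 𝓡 n) x
  rw [extDer_apply (hθ.add hη) hxx, extDer_apply hθ hxx, extDer_apply hη hxx]
  exact extDerivFlat_add (hθ.dualSmoothAt hxx) (hη.dualSmoothAt hxx) _

/-- The Leibniz rule for `L_X (f i_Y θ)`. -/
theorem lieDer_smul_interior {k l : ℤ} (hk : 0 < k) (hm : 0 ≤ l - k + 1)
    {X Y : MultivectorField n M} (hX : X.IsKVector k) (hY : Y.IsKVector (l - k + 1))
    {θ : FormField n M} (hθ : θ.IsSmooth) {f : M → ℝ} (hf : IsSmoothFun n f) (x : M) :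
    ((-1 : ℝ) ^ ((k - 1) * (l - 1))) * lieDer k X (f • interior Y θ) x 1 =
      f x * (((-1 : ℝ) ^ ((k - 1) * (l - 1))) * lieDer k X (interior Y θ) x 1) +
        θ x (schouten k 0 X (ofFun n f) x * Y x) := by
  have hxx := mem_extChartAt_source (I := 𝓡 n) x
  -- Natural degrees: `X` has degree `p + 1`, `Y` has degree `q`, and `l = q + p`.
  obtain ⟨p, rfl⟩ : ∃ p : ℕ, k = ((p + 1 : ℕ) : ℤ) := ⟨(k - 1).toNat, by omega⟩
  obtain ⟨q, hq⟩ : ∃ q : ℕ, l - ((p + 1 : ℕ) : ℤ) + 1 = (q : ℤ) := ⟨_, (Int.toNat_of_nonneg hm).symm⟩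
  obtain rfl : l = q + p := by push_cast at hq; omega
  rw [lieDer_apply_one, lieDer_apply_one, extDer_smul hf (.interior hY.1 hθ)]
  have hsch : θ x (schouten ((p + 1 : ℕ) : ℤ) 0 X (ofFun n f) x * Y x) =
      θ.inChart x (extChartAt (𝓡 n) x x)
        (CliffordAlgebra.contractRight (X.inChart x (extChartAt (𝓡 n) x x))
        (fderiv ℝ (fun z => f ((extChartAt (𝓡 n) x).symm z)) (extChartAt (𝓡 n) x x)).toLinearMap *
          Y.inChart x (extChartAt (𝓡 n) x x)) := by
    rw [← schouten_ofFun_inChart _ X f, MultivectorField.inChart_apply _ hxx,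
      MultivectorField.inChart_apply _ hxx, ← map_mul, θ.inChart_apply hxx]
  have hXc : X.inChart x (extChartAt (𝓡 n) x x) ∈ ⋀[ℝ]^(p + 1) (Model n) := by
    rw [X.inChart_apply hxx]
    exact map_mem_extPow (chartDiff x x) (hX.2 x)
  have hYc : Y.inChart x (extChartAt (𝓡 n) x x) ∈ ⋀[ℝ]^q (Model n) := by
    rw [Y.inChart_apply hxx]
    exact map_mem_extPow (p := (q : ℤ)) (chartDiff x x) (hq ▸ hY.2 x)
  rw [hsch, inChart_interior Y θ hxx, LinearMap.comp_apply, LinearMap.mulLeft_apply,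
    contractRight_mul_comm _ hXc hYc, map_smul, smul_eq_mul]
  -- The exponents add up to `p(p+1) + 2pq + 1`, which is odd; the resulting `-1` cancels the minus
  -- sign in `lieDer_apply_one`. This is what the factor `(-1)^((k-1)(l-1))` is designed for.
  have hs : ((-1 : ℝ) ^ ((((p + 1 : ℕ) : ℤ) - 1) * ((q : ℤ) + p - 1))) * (-1 : ℝ) ^ ((p + 1 : ℕ) : ℤ) *
      (-1) ^ (p * q + p) = -1 := by
    rw [← zpow_natCast (-1 : ℝ) (p * q + p), ← zpow_add₀ (by norm_num), ← zpow_add₀ (by norm_num)]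
    have : Odd ((((p + 1 : ℕ) : ℤ) - 1) * ((q : ℤ) + p - 1) + ((p + 1 : ℕ) : ℤ) +
        ((p * q + p : ℕ) : ℤ)) := by
      have h2 : Even ((p : ℤ) * (p + 1)) := Int.even_mul_succ_self p
      obtain ⟨r, hr⟩ := h2
      refine ⟨p * q + r, ?_⟩
      push_cast
      linear_combination hr
    exact this.neg_one_zpow
  linear_combination (-θ.inChart x (extChartAt (𝓡 n) x x)
        (CliffordAlgebra.contractRight (X.inChart x (extChartAt (𝓡 n) x x))
        (fderiv ℝ (fun z => f ((extChartAt (𝓡 n) x).symm z)) (extChartAt (𝓡 n) x x)).toLinearMap *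
          Y.inChart x (extChartAt (𝓡 n) x x))) * hs

end Leibniz

/-! ### The covariant derivative -/

namespace HigherConnection

variable {n : ℕ} {M : Type*} [TopologicalSpace M] [ChartedSpace (EuclideanSpace ℝ (Fin n)) M]

/-- The value that the covariant derivative of `θ` along `X` has to take on `Y`. -/
noncomputable def covExpr (C : HigherConnection n M) (k l : ℤ) (X : MultivectorField n M)
    (θ : FormField n M) (Y : MultivectorField n M) (x : M) : ℝ :=
  ((-1 : ℝ) ^ ((k - 1) * (l - 1))) * lieDer k X (interior Y θ) x 1 - θ x (C.D X Y x)

theorem interior_smul (f : M → ℝ) (Y : MultivectorField n M) (θ : FormField n M) :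
    interior (f • Y) θ = f • interior Y θ := by
  funext x
  refine LinearMap.ext fun v => ?_
  change θ x ((f x • Y x) * v) = f x * θ x (Y x * v)
  rw [smul_mul_assoc, map_smul, smul_eq_mul]

/-- The covariant derivative, by its values on the coordinate multivectors. -/
noncomputable def covForm (C : HigherConnection n M) (k l : ℤ) (X : MultivectorField n M)
    (θ : FormField n M) : FormField n M := fun x =>
  ∑ s : Finset (Fin n) with (s.card : ℤ) = l - k + 1,
    C.covExpr k l X θ (frameField n x s) x •
      ((wedgeBasis n).coord s ∘ₗ (ExteriorAlgebra.map (chartDiff x x)).toLinearMap)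

theorem covForm_apply_eq_sum (C : HigherConnection n M) {k l : ℤ}
    {X : MultivectorField n M} {θ : FormField n M} (x : M) (v : ExteriorAlgebra ℝ (TangentSpace (𝓡 n) x)) :
    C.covForm k l X θ x v = ∑ s : Finset (Fin n) with (s.card : ℤ) = l - k + 1,
      C.covExpr k l X θ (frameField n x s) x *
        (wedgeBasis n).repr (ExteriorAlgebra.map (chartDiff x x) v) s := by
  rw [covForm, LinearMap.sum_apply]
  rfl

theorem covDer_of_neg {C : HigherConnection n M} {k l : ℤ} {X : MultivectorField n M}
    {θ : FormField n M} (hm : l - k + 1 < 0) : C.covDer k l X θ = 0 :=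
  dif_neg fun h => by omega

variable [IsManifold (𝓡 n) ∞ M] (C : HigherConnection n M)

theorem D_smul_left {X Y : MultivectorField n M} (hX : X.IsSmooth) (hY : Y.IsSmooth) {f : M → ℝ}
    (hf : IsSmoothFun n f) : C.D (f • X) Y = f • C.D X Y := by
  -- With `f = 1` and both arguments zero, the axiom says that `∇_0 Y` equals its own double, hence
  -- vanishes.
  have h0 := C.linear_left 1 0 0 Y (isSmoothFun_const 1) MultivectorField.isSmooth_zero
    MultivectorField.isSmooth_zero hY
  rw [one_smul, one_smul, add_zero] at h0
  have h := C.linear_left f X 0 Y hf hX MultivectorField.isSmooth_zero hY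
  rwa [add_zero, left_eq_add.1 h0, add_zero] at h

variable {k l : ℤ} {X : MultivectorField n M} {θ : FormField n M}

theorem covExpr_add (hX : X.IsSmooth) (hθ : θ.IsSmooth) {Y Y' : MultivectorField n M}
    (hY : Y.IsSmooth) (hY' : Y'.IsSmooth) (x : M) :
    C.covExpr k l X θ (Y + Y') x = C.covExpr k l X θ Y x + C.covExpr k l X θ Y' x := by
  have h : interior (Y + Y') θ = interior Y θ + interior Y' θ := by
    funext x
    refine LinearMap.ext fun v => ?_
    change θ x ((Y x + Y' x) * v) = θ x (Y x * v) + θ x (Y' x * v)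
    rw [add_mul, map_add]
  simp only [covExpr, lieDer_apply_one]
  rw [h, extDer_add (.interior hY hθ) (.interior hY' hθ), C.add_right X Y Y' hX hY hY',
    Pi.add_apply, map_add]
  ring

/-- Tensoriality in `Y`: the term `θ([X,f] ∧ Y)` arises from the Lie derivative and again, with the
opposite sign, from the Leibniz rule of the connection. -/
theorem covExpr_smul (hk : 0 < k) (hm : 0 ≤ l - k + 1) (hX : X.IsKVector k) (hθ : θ.IsSmooth)
    {Y : MultivectorField n M} (hY : Y.IsKVector (l - k + 1)) {f : M → ℝ} (hf : IsSmoothFun n f)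
    (x : M) : C.covExpr k l X θ (f • Y) x = f x * C.covExpr k l X θ Y x := by
  rw [covExpr, covExpr, interior_smul, lieDer_smul_interior hk hm hX hY hθ hf,
    C.leibniz k X Y f hX hf hY.1]
  have : θ x ((schouten k 0 X (ofFun n f) * Y + f • C.D X Y) x) =
      θ x (schouten k 0 X (ofFun n f) x * Y x) + f x * θ x (C.D X Y x) := by
    rw [Pi.add_apply, map_add, Pi.mul_apply, Pi.smul_apply', map_smul, smul_eq_mul]
  rw [this]
  ring

theorem covExpr_zero (hX : X.IsSmooth) (hθ : θ.IsSmooth) (x : M) :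
    C.covExpr k l X θ 0 x = 0 := by
  have h := C.covExpr_add (k := k) (l := l) hX hθ MultivectorField.isSmooth_zero
    MultivectorField.isSmooth_zero x
  rw [add_zero] at h
  exact left_eq_add.1 h

theorem covExpr_sum (hk : 0 < k) (hm : 0 ≤ l - k + 1) (hX : X.IsKVector k) (hθ : θ.IsSmooth)
    {ι : Type*} (t : Finset ι) {f : ι → M → ℝ} {Y : ι → MultivectorField n M}
    (hf : ∀ i ∈ t, IsSmoothFun n (f i)) (hY : ∀ i ∈ t, (Y i).IsKVector (l - k + 1)) (x : M) :
    C.covExpr k l X θ (∑ i ∈ t, f i • Y i) x = ∑ i ∈ t, f i x * C.covExpr k l X θ (Y i) x := by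
  classical
  induction t using Finset.induction_on with
  | empty => simpa using C.covExpr_zero hX.1 hθ x
  | insert a t ha ih =>
    have ht : (∑ i ∈ t, f i • Y i).IsKVector (l - k + 1) :=
      MultivectorField.isKVector_sum t fun i hi => .smul (hf i (by simp [hi])) (hY i (by simp [hi]))
    rw [Finset.sum_insert ha, Finset.sum_insert ha, C.covExpr_add hX.1 hθ
      (.smul (hf a (by simp)) (hY a (by simp)).1) ht.1,
      C.covExpr_smul hk hm hX hθ (hY a (by simp)) (hf a (by simp)),
      ih (fun i hi => hf i (by simp [hi])) fun i hi => hY i (by simp [hi])]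

theorem contDiffAt_covExpr (hX : X.IsSmooth) (hθ : θ.IsSmooth) {Y : MultivectorField n M}
    (hY : Y.IsSmooth) {x₀ x : M} (hx : x ∈ (extChartAt (𝓡 n) x₀).source) :
    ContDiffAt ℝ ∞ (fun y => C.covExpr k l X θ Y ((extChartAt (𝓡 n) x₀).symm y))
      (extChartAt (𝓡 n) x₀ x) := by
  simp only [covExpr, lieDer_apply_one]
  exact ((contDiffAt_const.mul
    (contDiffAt_const.mul (contDiffAt_extDer (.interior hY hθ) hX hx)).neg)).sub
      (contDiffAt_formField_apply hθ (C.smooth X Y hX hY) hx)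

variable [T2Space M]

/-- Multiplying `Y` by `ρ²` does not change `E(Y)` at `x`, because `ρ(x) = 1`; the frame expansion
of `ρ² Y` and linearity then give the defining sum of `covForm`. -/
theorem covForm_apply (hk : 0 < k) (hm : 0 ≤ l - k + 1) (hX : X.IsKVector k) (hθ : θ.IsSmooth)
    {Y : MultivectorField n M} (hY : Y.IsKVector (l - k + 1)) (x : M) :
    C.covForm k l X θ x (Y x) = C.covExpr k l X θ Y x := by
  have hb := isSmoothFun_bump (n := n) x
  have h1 := C.covExpr_smul hk hm hX hθ hY (ContMDiff.mul hb hb) x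
  have h2 := congrArg (fun Z => C.covExpr k l X θ Z x) (bump_sq_smul_eq_sum hY x)
  have h3 := C.covExpr_sum hk hm hX hθ
    {s : Finset (Fin n) | (s.card : ℤ) = l - k + 1} (f := fun s => cutoffCoord Y x s)
    (Y := fun s => frameField n x s) (fun s _ => isSmoothFun_cutoffCoord hY.1 x s)
    (fun s hs => (Finset.mem_filter.1 hs).2 ▸ frameField_isKVector x s) x
  have h4 : C.covExpr k l X θ (((fun x' => bump (n := n) x x' * bump (n := n) x x') : M → ℝ) • Y) x =
      C.covExpr k l X θ Y x := by
    refine h1.trans ?_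
    simp
  rw [← h4, h2, h3, covForm_apply_eq_sum]
  refine Finset.sum_congr rfl fun s _ => ?_
  rw [cutoffCoord, bump_self, one_mul, Y.inChart_apply (mem_extChartAt_source x), mul_comm]

theorem covForm_isForm (hk : 0 < k) (hm : 0 ≤ l - k + 1) (hX : X.IsKVector k) (hθ : θ.IsSmooth) :
    (C.covForm k l X θ).IsForm (l - k + 1) := by
  have hdeg : ∀ (x : M) (m : ℤ), m ≠ l - k + 1 → ∀ v ∈ extPow (TangentSpace (𝓡 n) x) m,
      C.covForm k l X θ x v = 0 := by
    intro x m hmne v hv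
    rw [covForm_apply_eq_sum]
    refine Finset.sum_eq_zero fun s hs => ?_
    rw [wedgeBasis_repr_eq_zero_of_mem_extPow (map_mem_extPow _ hv)
      ((Finset.mem_filter.1 hs).2.trans_ne hmne.symm), mul_zero]
  refine ⟨FormField.isSmooth_of_dualSmoothAt fun x => ⟨x, mem_extChartAt_source x, fun s => ?_⟩, hdeg⟩
  have hxx := mem_extChartAt_source (I := 𝓡 n) x
  by_cases hs : (s.card : ℤ) = l - k + 1
  · have hF : (frameField n x s).IsKVector (l - k + 1) := hs ▸ frameField_isKVector x s
    -- The definition of `covForm` uses a different frame at each point. Where the bump function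
    -- around `x` equals `1`, `covForm_apply` expresses the component through the single frame field
    -- centred at `x`.
    refine (C.contDiffAt_covExpr (k := k) (l := l) hX.1 hθ hF.1 hxx).congr_of_eventuallyEq ?_
    refine eventually_chart hxx (p := fun y x' => (C.covForm k l X θ).inChart x y (wedgeBasis n s) =
      C.covExpr k l X θ (frameField n x s) x') ?_
    filter_upwards [extChartAt_source_mem_nhds' hxx, (bump (n := n) x).eventuallyEq_one]
      with x' hx' hb
    have h := frameField_inChart s hx'
    rw [hb, Pi.one_apply, one_smul] at h
    rw [← h, FormField.inChart_apply_inChart _ _ hx', C.covForm_apply hk hm hX hθ hF]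
  · refine contDiffAt_const (c := (0 : ℝ)).congr_of_eventuallyEq ?_
    refine eventually_chart hxx (p := fun y (_ : M) =>
      (C.covForm k l X θ).inChart x y (wedgeBasis n s) = 0) ?_
    filter_upwards [extChartAt_source_mem_nhds' hxx] with x' hx'
    rw [← map_chartDiff_chartInv hx' (wedgeBasis n s), FormField.inChart_apply _ hx']
    exact hdeg x' _ hs _ (map_mem_extPow _ (p := (s.card : ℤ)) (wedgeBasis_mem s))

theorem isCovDer_covForm (hk : 0 < k) (hm : 0 ≤ l - k + 1) (hX : X.IsKVector k)
    (hθ : θ.IsSmooth) : C.IsCovDer k l X θ (C.covForm k l X θ) :=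
  ⟨C.covForm_isForm hk hm hX hθ, fun _ hY x => C.covForm_apply hk hm hX hθ hY x⟩

variable {C}

theorem IsCovDer.eq {η η' : FormField n M} (h : C.IsCovDer k l X θ η)
    (h' : C.IsCovDer k l X θ η') : η = η' :=
  h.1.ext h'.1 fun Y hY x => (h.2 Y hY x).trans (h'.2 Y hY x).symm

theorem isCovDer_covDer (hk : 0 < k) (hm : 0 ≤ l - k + 1) (hX : X.IsKVector k)
    (hθ : θ.IsSmooth) : C.IsCovDer k l X θ (C.covDer k l X θ) := by
  have h : 0 < k ∧ 0 ≤ l - k + 1 ∧ ∃ η : FormField n M, C.IsCovDer k l X θ η :=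
    ⟨hk, hm, _, C.isCovDer_covForm hk hm hX hθ⟩
  rw [covDer, dif_pos h]
  exact h.2.2.choose_spec

theorem covDer_isForm (hk : 0 < k) (hX : X.IsKVector k) (hθ : θ.IsSmooth) :
    (C.covDer k l X θ).IsForm (l - k + 1) := by
  rcases lt_or_ge (l - k + 1) 0 with hm | hm
  · rw [covDer_of_neg hm]; exact FormField.isForm_zero _
  · exact (isCovDer_covDer hk hm hX hθ).1

theorem covDer_apply (hk : 0 < k) (hX : X.IsKVector k) (hθ : θ.IsSmooth)
    {Y : MultivectorField n M} (hY : Y.IsKVector (l - k + 1)) (x : M) :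
    C.covDer k l X θ x (Y x) = C.covExpr k l X θ Y x := by
  rcases lt_or_ge (l - k + 1) 0 with hm | hm
  · have h0 : Y = 0 := funext fun x => eq_zero_of_mem_extPow_neg hm (hY.2 x)
    rw [h0, C.covExpr_zero hX.1 hθ]
    exact map_zero _
  · exact (isCovDer_covDer hk hm hX hθ).2 Y hY x

/-- A form of the right degree with the right values is the covariant derivative. -/
theorem covDer_eq (hk : 0 < k) (hX : X.IsKVector k) (hθ : θ.IsSmooth) {η : FormField n M}
    (hη : η.IsForm (l - k + 1))
    (h : ∀ Y : MultivectorField n M, Y.IsKVector (l - k + 1) → 0 ≤ l - k + 1 → ∀ x,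
      C.covExpr k l X θ Y x = η x (Y x)) : C.covDer k l X θ = η := by
  rcases lt_or_ge (l - k + 1) 0 with hm | hm
  · rw [covDer_of_neg hm, hη.eq_zero hm]
  · exact (covDer_isForm hk hX hθ).ext hη fun Y hY x =>
      (covDer_apply hk hX hθ hY x).trans (h Y hY hm x)

/-! ### The identities (i), (ii) and (iii) -/

theorem covDer_smul_left (hk : 0 < k) (hX : X.IsKVector k) (hθ : θ.IsSmooth) {f : M → ℝ}
    (hf : IsSmoothFun n f) : C.covDer k l (f • X) θ = f • C.covDer k l X θ := by
  refine covDer_eq hk (.smul hf hX) hθ (.smul hf (covDer_isForm hk hX hθ)) fun Y hY _ x => ?_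
  have h : (f • C.covDer k l X θ) x (Y x) = f x * C.covExpr k l X θ Y x :=
    congrArg (f x * ·) (covDer_apply hk hX hθ hY x)
  -- After `lieDer_apply_one`, `X` occurs only as an argument of `d i_Y θ` and on the left of the
  -- connection, so `f` factors out of both.
  rw [h, covExpr, covExpr, lieDer_apply_one, lieDer_apply_one, C.D_smul_left hX.1 hY.1 hf,
    Pi.smul_apply', Pi.smul_apply', map_smul, map_smul, smul_eq_mul, smul_eq_mul]
  ring

theorem covDer_smul_right (hk : 0 < k) (hX : X.IsKVector k) (hθ : θ.IsForm l) {f : M → ℝ}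
    (hf : IsSmoothFun n f) : C.covDer k l X (f • θ) =
      f • C.covDer k l X θ + interior (schouten k 0 X (ofFun n f)) θ := by
  have hsm : (ofFun n f : MultivectorField n M).IsKVector 0 := by
    refine ⟨MultivectorField.isSmooth_of_compSmoothAt fun x => ⟨x, mem_extChartAt_source x, ?_⟩,
      fun x => ?_⟩
    · exact (CompSmoothAt.smul (hf.contDiffAt (mem_extChartAt_source x))
        (CompSmoothAt.const _ _)).congr (.of_forall fun y => ofFun_inChart f x y)
    · rw [ofFun, Algebra.algebraMap_eq_smul_one]
      exact Submodule.smul_mem _ _ one_mem_exteriorPower_zero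
  -- Smoothness and degree of `[X,f]` come from the connection itself, since `[X,f] = ∇_X f`.
  have hsch : (schouten k 0 X (ofFun n f)).IsKVector (k - 1) := by
    rw [← C.apply_fun k X f hX hf]
    simpa using C.degree k 0 X _ hX hsm
  have hint : (interior (schouten k 0 X (ofFun n f)) θ).IsForm (l - k + 1) := by
    convert hθ.interior hsch using 1
    ring
  refine covDer_eq hk hX (.smul hf hθ.1) (.add (.smul hf (covDer_isForm hk hX hθ.1)) hint)
    fun Y hY hm x => ?_
  have h : (f • C.covDer k l X θ + interior (schouten k 0 X (ofFun n f)) θ) x (Y x) =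
      f x * C.covExpr k l X θ Y x + θ x (schouten k 0 X (ofFun n f) x * Y x) :=
    congrArg (f x * · + θ x (schouten k 0 X (ofFun n f) x * Y x)) (covDer_apply hk hX hθ.1 hY x)
  have hi : interior Y (f • θ) = f • interior Y θ := rfl
  rw [h, covExpr, covExpr, hi, lieDer_smul_interior hk hm hX hY hθ.1 hf, Pi.smul_apply',
    LinearMap.smul_apply, smul_eq_mul]
  ring

theorem covDer_interior (hC : C.IsUpperInduced) (hk : 0 < k) (hX : X.IsKVector k)
    (hθ : θ.IsForm l) {j : ℤ} {W : MultivectorField n M} (hW : W.IsKVector j) :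
    C.covDer k (l - j) X (interior W θ) = ((-1 : ℝ) ^ (j * (k - 1))) •
      (interior W (C.covDer k l X θ) + interior (C.D X W) θ) := by
  have h1 : (interior W (C.covDer k l X θ)).IsForm (l - j - k + 1) := by
    convert (covDer_isForm (C := C) hk hX hθ.1).interior hW using 1
    ring
  have h2 : (interior (C.D X W) θ).IsForm (l - j - k + 1) := by
    convert hθ.interior (C.degree k j X W hX hW) using 1
    ring
  refine covDer_eq hk hX (.interior hW.1 hθ.1)
    (FormField.IsForm.smul (f := fun _ => (-1 : ℝ) ^ (j * (k - 1))) (isSmoothFun_const _)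
      (h1.add h2)) fun Y hY _ x => ?_
  have hWY : (W * Y).IsKVector (l - k + 1) := by
    convert hW.mul hY using 1
    ring
  have h : (((-1 : ℝ) ^ (j * (k - 1))) •
      (interior W (C.covDer k l X θ) + interior (C.D X W) θ)) x (Y x) =
      (-1 : ℝ) ^ (j * (k - 1)) * (C.covExpr k l X θ (W * Y) x + θ x (C.D X W x * Y x)) :=
    congrArg (fun r => (-1 : ℝ) ^ (j * (k - 1)) * (r + θ x (C.D X W x * Y x)))
      (covDer_apply hk hX hθ.1 hWY x)
  refine Eq.trans ?_ h.symm
  have hi : interior Y (interior W θ) = interior (W * Y) θ := by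
    funext x
    refine LinearMap.ext fun v => ?_
    change θ x (W x * (Y x * v)) = θ x (W x * Y x * v)
    rw [mul_assoc]
  have hD : θ x (C.D X (W * Y) x) = θ x (C.D X W x * Y x) +
      (-1 : ℝ) ^ ((k - 1) * j) * θ x (W x * C.D X Y x) := by
    rw [hC k j X W Y hX hW hY.1, Pi.add_apply, map_add, Pi.mul_apply, Pi.smul_apply, map_smul,
      Pi.mul_apply, smul_eq_mul]
  have hi2 : interior W θ x (C.D X Y x) = θ x (W x * C.D X Y x) := rfl
  -- Lowering the degree of the form by `j` changes the sign factor by `(-1)^(j(k-1))`, the overall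
  -- sign in (iii).
  have hs1 : (-1 : ℝ) ^ ((k - 1) * (l - j - 1)) =
      (-1) ^ (j * (k - 1)) * (-1) ^ ((k - 1) * (l - 1)) := by
    rw [← zpow_add₀ (by norm_num)]
    exact neg_one_zpow_congr ⟨-(j * (k - 1)), by ring⟩
  -- The same sign appears in the upper induced rule for `∇_X (W ∧ Y)`; the two cancel on the term
  -- `θ(W ∧ ∇_X Y)`.
  have hs2 : (-1 : ℝ) ^ (j * (k - 1)) * (-1) ^ ((k - 1) * j) = 1 := by
    rw [← zpow_add₀ (by norm_num)]
    exact Even.neg_one_zpow ⟨j * (k - 1), by ring⟩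
  rw [covExpr, covExpr, hi, hi2, hD, hs1]
  linear_combination θ x (W x * C.D X Y x) * hs2

end HigherConnection

end HigherAffine

open HigherAffine in
theorem mainTheorem7 (n : ℕ) (M : Type*) [TopologicalSpace M] [T2Space M]
    [SecondCountableTopology M] [ChartedSpace (EuclideanSpace ℝ (Fin n)) M] [IsManifold (𝓡 n) ∞ M]
    (C : HigherConnection n M) (k l : ℤ) (hk : 0 < k)
    (X : MultivectorField n M) (hX : X.IsKVector k)
    (θ : FormField n M) (hθ : θ.IsForm l) :
    (0 ≤ l - k + 1 → (∃! η : FormField n M, C.IsCovDer k l X θ η) ∧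
      C.IsCovDer k l X θ (C.covDer k l X θ)) ∧
    (∀ f : M → ℝ, IsSmoothFun n f →
      C.covDer k l (f • X) θ = f • C.covDer k l X θ) ∧
    (∀ f : M → ℝ, IsSmoothFun n f →
      C.covDer k l X (f • θ) =
        f • C.covDer k l X θ + interior (schouten k 0 X (ofFun n f)) θ) ∧
    (C.IsUpperInduced → ∀ (j : ℤ) (W : MultivectorField n M), W.IsKVector j →
      C.covDer k (l - j) X (interior W θ) =
        ((-1 : ℝ) ^ (j * (k - 1))) •
          (interior W (C.covDer k l X θ) + interior (C.D X W) θ)) := by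
  refine ⟨fun hm => ⟨?_, HigherConnection.isCovDer_covDer hk hm hX hθ.1⟩,
    fun f hf => HigherConnection.covDer_smul_left hk hX hθ.1 hf,
    fun f hf => HigherConnection.covDer_smul_right hk hX hθ hf,
    fun hC j W hW => HigherConnection.covDer_interior hC hk hX hθ hW⟩
  exact ⟨_, HigherConnection.isCovDer_covDer hk hm hX hθ.1,
    fun η hη => hη.eq (HigherConnection.isCovDer_covDer hk hm hX hθ.1)⟩
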